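/- Let $G$ be a finite group. A rational $G$-Mackey functor $M$ consists of $\mathbb{Q}$-modules $M(G/H)$ for $H\le G$, with restriction maps $R^H_K$, induction maps $I^H_K$ (for $K\le H$) and conjugation maps $C_g\colon M(G/H)\to M(G/gHg^{-1})$ (for $g\in G$), which are linear and satisfy the usual axioms: identities ($R^H_H=I^H_H=\mathrm{id}$, and $C_h=\mathrm{id}$ on $M(G/H)$ for $h\in H$), transitivity, equivariance, and the Mackey double coset formula. Let $\mathrm{Mack}_{\mathbb Q}(G)$ be the category of these. The rational Burnside ring $A_{\mathbb Q}(K)$ acts on $M(G/K)$ by linear extension of $[K/L]\mapsto I^K_L\circ R^K_L$. For $H\le G$ let $W_GH=N_GH/H$, and let $e_H^G\in A_{\mathbb Q}(G)$ be the idempotent that corresponds to the characteristic function of the conjugacy class $(H)$ under the isomorphism $A_{\mathbb Q}(G)\cong C(\mathrm{Sub}(G)/G,\mathbb Q)$, $T\mapsto\big((K)\mapsto |T^K|\big)$. Let $e_H^G\mathrm{Mack}_{\mathbb Q}(G)$ be the full subcategory of those $M$ with $M=e_H^GM$, i.e. $R^G_K(e_H^G)\,M(G/K)=M(G/K)$ for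 all $K\le G$. Let $U_H$ be the functor from it to $\mathbb{Q}[W_GH]$-modules given by $U_H(M)=M(G/H)$, where $W_GH$ acts through the conjugation maps. For a $\mathbb{Q}[W_GH]$-module $V$ let $F_H(V)$ be the Mackey functor $$F_H(V)(G/K)=\Big(\bigoplus_{\sigma\in (G/K)^H}V\Big)^{W_GH}\cong\big(\mathbb{Q}[(G/K)^H]\otimes V\big)^{W_GH},$$ that is, the families $(y_\sigma)_{\sigma\in(G/K)^H}$ in $V$ with $y_{n\sigma}=n\,y_\sigma$ for $n\in N_GH$. For $L\le K$ with projection $\alpha\colon G/L\to G/K$, its structure maps are $(R^K_Ly)_\sigma=y_{\alpha\sigma}$ and $(I^K_Ly)_\tau=\sum_{\alpha\sigma=\tau}y_\sigma$; moreover $(C_gy)_{x\,gKg^{-1}}=y_{xgK}$. **Theorem.** (1) For each $H\le G$, the functor $F_H$ takes values in $e_H^G\mathrm{Mack}_{\mathbb Q}(G)$, and $U_H$ and $F_H$ are mutually inverse equivalences of categories $$U_H\colon e_H^G\,\mathrm{Mack}_{\mathbb Q}(G)\ \rightleftarrows\ \mathbb{Q}[W_GH]\text{-mod}\ :F_H .$$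 (2) There is an equivalence of categories $$\mathrm{Mack}_{\mathbb Q}(G)\ \simeq\ \prod_{(H)\le G}\mathbb{Q}[W_GH]\text{-mod},$$ where the product runs over the conjugacy classes of subgroups of $G$, with one representative $H$ chosen (arbitrarily) in each class. -/

import Mathlib

open CategoryTheory
open scoped Pointwise MonoidAlgebra

universe u v w

namespace RatMackey

/-! ### Rational Mackey functors -/

/-- `s` is a complete system of representatives in `H` of the double cosets `K \ H / L`. -/
def IsDoubleCosetReps {G : Type u} [Group G] (K H L : Subgroup G) (s : Finset G) : Prop :=
  (∀ x ∈ s, x ∈ H) ∧ ∀ h ∈ H, ∃! x, x ∈ s ∧ ∃ k ∈ K, ∃ l ∈ L, h = k * x * l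

theorem conj_inf {G : Type u} [Group G] (x : G) (K L : Subgroup G) :
    K ⊓ MulAut.conj x • L = MulAut.conj x • (L ⊓ MulAut.conj x⁻¹ • K) := by
  rw [Subgroup.smul_inf, smul_smul, ← map_mul, mul_inv_cancel, map_one, one_smul, inf_comm]

/-- A rational `G`-Mackey functor. Here `obj H` is the value at `G/H`, and
`conj g e : obj H → obj H'` is the conjugation map `C_g`, where `e : H' = g H g⁻¹`. -/
structure MackeyFunctor (G : Type u) [Group G] where
  obj : Subgroup G → Type v
  [addCommGroup : ∀ H, AddCommGroup (obj H)]
  [module : ∀ H, Module ℚ (obj H)]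
  res : ∀ {K H : Subgroup G}, K ≤ H → (obj H →ₗ[ℚ] obj K)
  ind : ∀ {K H : Subgroup G}, K ≤ H → (obj K →ₗ[ℚ] obj H)
  conj : ∀ (g : G) {H H' : Subgroup G}, H' = MulAut.conj g • H → (obj H →ₗ[ℚ] obj H')
  res_self : ∀ (H : Subgroup G) (m : obj H), res (le_refl H) m = m
  ind_self : ∀ (H : Subgroup G) (m : obj H), ind (le_refl H) m = m
  conj_self : ∀ {H : Subgroup G} (h : G) (_ : h ∈ H) (e : H = MulAut.conj h • H) (m : obj H),
    conj h e m = m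
  res_trans : ∀ {L K H : Subgroup G} (hLK : L ≤ K) (hKH : K ≤ H) (m : obj H),
    res (hLK.trans hKH) m = res hLK (res hKH m)
  ind_trans : ∀ {L K H : Subgroup G} (hLK : L ≤ K) (hKH : K ≤ H) (m : obj L),
    ind (hLK.trans hKH) m = ind hKH (ind hLK m)
  conj_mul : ∀ (g h : G) {H H' H'' : Subgroup G} (e : H' = MulAut.conj h • H)
    (e' : H'' = MulAut.conj g • H') (e'' : H'' = MulAut.conj (g * h) • H) (m : obj H),
    conj (g * h) e'' m = conj g e' (conj h e m)
  res_conj : ∀ (g : G) {K H K' H' : Subgroup G} (hKH : K ≤ H) (hKH' : K' ≤ H')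
    (eK : K' = MulAut.conj g • K) (eH : H' = MulAut.conj g • H) (m : obj H),
    res hKH' (conj g eH m) = conj g eK (res hKH m)
  ind_conj : ∀ (g : G) {K H K' H' : Subgroup G} (hKH : K ≤ H) (hKH' : K' ≤ H')
    (eK : K' = MulAut.conj g • K) (eH : H' = MulAut.conj g • H) (m : obj K),
    ind hKH' (conj g eK m) = conj g eH (ind hKH m)
  mackey : ∀ {K L H : Subgroup G} (hK : K ≤ H) (hL : L ≤ H) (s : Finset G),
    IsDoubleCosetReps K H L s → ∀ m : obj L,
      res hK (ind hL m) = ∑ x ∈ s,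
        ind (K := K ⊓ MulAut.conj x • L) (H := K) inf_le_left
          (conj x (conj_inf x K L)
            (res (K := L ⊓ MulAut.conj x⁻¹ • K) (H := L) inf_le_left m))

attribute [instance] MackeyFunctor.addCommGroup MackeyFunctor.module

namespace MackeyFunctor

variable {G : Type u} [Group G]

/-- Morphisms of Mackey functors: families of linear maps that commute with restriction,
induction and conjugation. -/
@[ext]
structure Hom (M N : MackeyFunctor.{u, v} G) where
  app : ∀ H : Subgroup G, M.obj H →ₗ[ℚ] N.obj H
  app_res : ∀ {K H : Subgroup G} (h : K ≤ H) (m : M.obj H),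
    app K (M.res h m) = N.res h (app H m)
  app_ind : ∀ {K H : Subgroup G} (h : K ≤ H) (m : M.obj K),
    app H (M.ind h m) = N.ind h (app K m)
  app_conj : ∀ (g : G) {H H' : Subgroup G} (e : H' = MulAut.conj g • H) (m : M.obj H),
    app H' (M.conj g e m) = N.conj g e (app H m)

instance : Category (MackeyFunctor.{u, v} G) where
  Hom M N := Hom M N
  id M :=
    { app := fun _ => LinearMap.id
      app_res := fun _ _ => rfl
      app_ind := fun _ _ => rfl
      app_conj := fun _ _ _ _ _ => rfl }
  comp f g :=
    { app := fun H => g.app H ∘ₗ f.app H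
      app_res := fun h m => by simp [f.app_res, g.app_res]
      app_ind := fun h m => by simp [f.app_ind, g.app_ind]
      app_conj := fun x _ _ e m => by simp [f.app_conj, g.app_conj] }

end MackeyFunctor

/-! ### The rational Burnside ring -/

/-- A finite `G`-set. -/
structure FinGSet (G : Type u) [Group G] where
  carrier : Type u
  [action : MulAction G carrier]
  [finite : Finite carrier]

attribute [instance] FinGSet.action FinGSet.finite

namespace FinGSet

variable {G : Type u} [Group G]

/-- Two finite `G`-sets are isomorphic if there is an equivariant bijection between them. -/
def Iso (X Y : FinGSet G) : Prop :=
  ∃ f : X.carrier ≃ Y.carrier, ∀ (g : G) (x : X.carrier), f (g • x) = g • f x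

instance isoSetoid (G : Type u) [Group G] : Setoid (FinGSet G) where
  r := Iso
  iseqv :=
    { refl := fun X => ⟨Equiv.refl _, fun _ _ => rfl⟩
      symm := by
        rintro X Y ⟨f, hf⟩
        exact ⟨f.symm, fun g y => by rw [Equiv.symm_apply_eq, hf, Equiv.apply_symm_apply]⟩
      trans := by
        rintro X Y Z ⟨f, hf⟩ ⟨f', hf'⟩
        exact ⟨f.trans f', fun g x => by simp [hf, hf']⟩ }

/-- Product of `G`-sets, with the diagonal action. -/
def prod (X Y : FinGSet G) : FinGSet G := ⟨X.carrier × Y.carrier⟩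

/-- The one-point `G`-set. -/
def point (G : Type u) [Group G] : FinGSet G where
  carrier := PUnit
  action := { smul := fun _ x => x, one_smul := fun _ => rfl, mul_smul := fun _ _ _ => rfl }

/-- Disjoint union of `G`-sets. -/
def sum (X Y : FinGSet G) : FinGSet G where
  carrier := X.carrier ⊕ Y.carrier
  action :=
    { smul := fun g => Sum.map (g • ·) (g • ·)
      one_smul := by
        rintro (x | y)
        · exact congrArg Sum.inl (one_smul G x)
        · exact congrArg Sum.inr (one_smul G y)
      mul_smul := by
        rintro g h (x | y)
        · exact congrArg Sum.inl (mul_smul g h x)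
        · exact congrArg Sum.inr (mul_smul g h y) }

/-- The transitive `G`-set `G/H`. -/
def orbit [Finite G] (H : Subgroup G) : FinGSet G := ⟨G ⧸ H⟩

/-- A `G`-set viewed as a `K`-set. -/
def restrict (K : Subgroup G) (X : FinGSet G) : FinGSet K := ⟨X.carrier⟩

@[simp] theorem smul_sum_inl (X Y : FinGSet G) (g : G) (x : X.carrier) :
    (g • (Sum.inl x : (sum X Y).carrier) : (sum X Y).carrier) = Sum.inl (g • x) := rfl

@[simp] theorem smul_sum_inr (X Y : FinGSet G) (g : G) (y : Y.carrier) :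
    (g • (Sum.inr y : (sum X Y).carrier) : (sum X Y).carrier) = Sum.inr (g • y) := rfl

end FinGSet

/-- Isomorphism classes of finite `G`-sets. -/
def IsoClass (G : Type u) [Group G] : Type (u + 1) := Quotient (FinGSet.isoSetoid G)

namespace IsoClass

variable {G : Type u} [Group G]

/-- The isomorphism class of a finite `G`-set. -/
def mk (X : FinGSet G) : IsoClass G := Quotient.mk _ X

theorem mk_eq_mk {X Y : FinGSet G} : mk X = mk Y ↔ FinGSet.Iso X Y := Quotient.eq

/-- The product of isomorphism classes is induced by the product of `G`-sets. -/
instance : CommMonoid (IsoClass G) where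
  mul := Quotient.map₂ FinGSet.prod (by
    rintro X X' ⟨f, hf⟩ Y Y' ⟨f', hf'⟩
    exact ⟨Equiv.prodCongr f f', fun g x => Prod.ext (hf g x.1) (hf' g x.2)⟩)
  one := mk (FinGSet.point G)
  mul_assoc := by
    rintro ⟨X⟩ ⟨Y⟩ ⟨Z⟩
    exact Quotient.sound ⟨Equiv.prodAssoc _ _ _, fun _ _ => rfl⟩
  one_mul := by
    rintro ⟨X⟩
    exact Quotient.sound ⟨Equiv.punitProd _, fun _ _ => rfl⟩
  mul_one := by
    rintro ⟨X⟩
    exact Quotient.sound ⟨Equiv.prodPUnit _, fun _ _ => rfl⟩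
  mul_comm := by
    rintro ⟨X⟩ ⟨Y⟩
    exact Quotient.sound ⟨Equiv.prodComm _ _, fun _ _ => rfl⟩

theorem mk_mul (X Y : FinGSet G) : mk X * mk Y = mk (FinGSet.prod X Y) := rfl

theorem one_def : (1 : IsoClass G) = mk (FinGSet.point G) := rfl

end IsoClass

/-- The additivity relations `[X ⊔ Y] - [X] - [Y]`. -/
def burnsideRel (G : Type u) [Group G] : Set ℚ[IsoClass G] :=
  {z | ∃ X Y : FinGSet G, z = MonoidAlgebra.single (IsoClass.mk (FinGSet.sum X Y)) 1
    - MonoidAlgebra.single (IsoClass.mk X) 1 - MonoidAlgebra.single (IsoClass.mk Y) 1}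

/-- The rational Burnside ring `A_ℚ(G)`: the rational Grothendieck ring of finite `G`-sets under
disjoint union and product. -/
abbrev BurnsideRing (G : Type u) [Group G] : Type (u + 1) :=
  ℚ[IsoClass G] ⧸ Ideal.span (burnsideRel G)

namespace BurnsideRing

variable {G : Type u} [Group G]

/-- The class in the Burnside ring of a finite `G`-set. -/
noncomputable def mk (X : FinGSet G) : BurnsideRing G :=
  Ideal.Quotient.mk _ (MonoidAlgebra.single (IsoClass.mk X) 1)

theorem mk_sum (X Y : FinGSet G) : mk (FinGSet.sum X Y) = mk X + mk Y := by
  rw [mk, mk, mk, ← map_add, Ideal.Quotient.mk_eq_mk_iff_sub_mem, ← sub_sub]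
  exact Ideal.subset_span ⟨X, Y, rfl⟩

theorem mk_iso {X Y : FinGSet G} (h : FinGSet.Iso X Y) : mk X = mk Y := by
  rw [mk, mk, IsoClass.mk_eq_mk.2 h]

/-- A multiplicative and additive isomorphism invariant of finite `G`-sets extends to an algebra
map on the Burnside ring. -/
noncomputable def liftAlgHom {A : Type w} [CommRing A] [Algebra ℚ A] (f : IsoClass G →* A)
    (hf : ∀ X Y : FinGSet G, f (IsoClass.mk (FinGSet.sum X Y)) =
      f (IsoClass.mk X) + f (IsoClass.mk Y)) : BurnsideRing G →ₐ[ℚ] A :=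
  Ideal.Quotient.liftₐ _ (MonoidAlgebra.lift ℚ A (IsoClass G) f) (by
    intro a ha
    have h : Ideal.span (burnsideRel G) ≤
        RingHom.ker (MonoidAlgebra.lift ℚ A (IsoClass G) f) := by
      rw [Ideal.span_le]
      rintro _ ⟨X, Y, rfl⟩
      simp [RingHom.mem_ker, hf]
    exact h ha)

theorem liftAlgHom_mk {A : Type w} [CommRing A] [Algebra ℚ A] (f : IsoClass G →* A)
    (hf : ∀ X Y : FinGSet G, f (IsoClass.mk (FinGSet.sum X Y)) =
      f (IsoClass.mk X) + f (IsoClass.mk Y)) (X : FinGSet G) :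
    liftAlgHom f hf (mk X) = f (IsoClass.mk X) := by
  change (MonoidAlgebra.lift ℚ A (IsoClass G) f) (MonoidAlgebra.single (IsoClass.mk X) 1) = _
  simp

/-- The restriction map `R_K : A_ℚ(G) → A_ℚ(K)`, given by restricting actions. -/
noncomputable def res (K : Subgroup G) : BurnsideRing G →ₐ[ℚ] BurnsideRing K :=
  liftAlgHom
    { toFun := Quotient.lift (fun X => mk (FinGSet.restrict K X)) (by
        rintro X Y ⟨f, hf⟩
        exact mk_iso ⟨f, fun g x => hf g x⟩)
      map_one' := by
        change mk (FinGSet.restrict K (FinGSet.point G)) = 1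
        exact mk_iso (Y := FinGSet.point K) ⟨Equiv.refl _, fun _ _ => rfl⟩
      map_mul' := by
        rintro ⟨X⟩ ⟨Y⟩
        change mk (FinGSet.restrict K (FinGSet.prod X Y)) =
          mk (FinGSet.restrict K X) * mk (FinGSet.restrict K Y)
        rw [mk, mk, mk, ← map_mul, MonoidAlgebra.single_mul_single, mul_one]
        rfl }
    (by
      intro X Y
      change mk (FinGSet.restrict K (FinGSet.sum X Y)) =
        mk (FinGSet.restrict K X) + mk (FinGSet.restrict K Y)
      rw [← mk_sum]
      refine mk_iso ⟨Equiv.refl _, ?_⟩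
      rintro g (x | y) <;> rfl)

theorem res_mk (K : Subgroup G) (X : FinGSet G) : res K (mk X) = mk (FinGSet.restrict K X) :=
  liftAlgHom_mk _ _ X

end BurnsideRing

/-! ### Marks, tom Dieck's isomorphism and the idempotents -/

/-- Conjugacy of subgroups. -/
instance conjSetoid (G : Type u) [Group G] : Setoid (Subgroup G) where
  r H K := ∃ g : G, K = MulAut.conj g • H
  iseqv :=
    { refl := fun H => ⟨1, by simp⟩
      symm := by
        rintro H K ⟨g, rfl⟩
        exact ⟨g⁻¹, by rw [smul_smul, ← map_mul, inv_mul_cancel, map_one, one_smul]⟩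
      trans := by
        rintro H K L ⟨g, rfl⟩ ⟨g', rfl⟩
        exact ⟨g' * g, by rw [smul_smul, ← map_mul]⟩ }

/-- The set `Sub(G)/G` of conjugacy classes of subgroups of `G`. -/
abbrev ConjSub (G : Type u) [Group G] : Type u := Quotient (conjSetoid G)

/-- The conjugacy class `(H)`. -/
abbrev ConjSub.mk {G : Type u} [Group G] (H : Subgroup G) : ConjSub G := Quotient.mk _ H

theorem mem_conj_iff {G : Type u} [Group G] {g x : G} {H : Subgroup G} :
    x ∈ MulAut.conj g • H ↔ g⁻¹ * x * g ∈ H := by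
  rw [Subgroup.mem_pointwise_smul_iff_inv_smul_mem, ← map_inv, MulAut.smul_def,
    MulAut.conj_apply, inv_inv]

namespace FinGSet

variable {G : Type u} [Group G]

/-- The number of `H`-fixed points of a finite `G`-set. -/
noncomputable def fixedCard (H : Subgroup G) (X : FinGSet G) : ℕ :=
  Nat.card {x : X.carrier // ∀ h ∈ H, h • x = x}

theorem fixedCard_iso (H : Subgroup G) {X Y : FinGSet G} (h : Iso X Y) :
    fixedCard H X = fixedCard H Y := by
  obtain ⟨f, hf⟩ := h
  refine Nat.card_congr (f.subtypeEquiv fun x => forall₂_congr fun h _ => ?_)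
  rw [← hf, f.apply_eq_iff_eq]

theorem fixedCard_conj (g : G) (H : Subgroup G) (X : FinGSet G) :
    fixedCard (MulAut.conj g • H) X = fixedCard H X := by
  refine Nat.card_congr ((MulAction.toPerm g⁻¹).subtypeEquiv fun x => ?_)
  simp only [MulAction.toPerm_apply]
  constructor
  · intro hx h hh
    have := hx (g * h * g⁻¹) (by rw [mem_conj_iff]; simpa [mul_assoc] using hh)
    rw [smul_smul, eq_inv_smul_iff, smul_smul, ← mul_assoc, this]
  · intro hx h hh
    have := hx _ (mem_conj_iff.1 hh)
    rwa [smul_smul, eq_inv_smul_iff, smul_smul, mul_assoc, mul_assoc, mul_inv_cancel_left,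
      mul_inv_cancel, mul_one] at this

theorem fixedCard_sum (H : Subgroup G) (X Y : FinGSet G) :
    fixedCard H (sum X Y) = fixedCard H X + fixedCard H Y := by
  rw [fixedCard, fixedCard, fixedCard, ← Nat.card_sum]
  refine Nat.card_congr ((Equiv.subtypeSum (α := X.carrier) (β := Y.carrier)).trans
    (Equiv.sumCongr (Equiv.subtypeEquivRight fun x => ?_) (Equiv.subtypeEquivRight fun x => ?_)))
  · exact forall₂_congr fun h _ => (by
      rw [← Sum.inl.injEq (α := X.carrier) (β := Y.carrier)]; rfl)
  · exact forall₂_congr fun h _ => (by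
      rw [← Sum.inr.injEq (α := X.carrier) (β := Y.carrier)]; rfl)

theorem fixedCard_prod (H : Subgroup G) (X Y : FinGSet G) :
    fixedCard H (prod X Y) = fixedCard H X * fixedCard H Y := by
  rw [fixedCard, fixedCard, fixedCard, ← Nat.card_prod]
  refine Nat.card_congr (Equiv.trans (Equiv.subtypeEquivRight fun x => ?_)
    (Equiv.subtypeProdEquivProd (p := fun x : X.carrier => ∀ h ∈ H, h • x = x)
      (q := fun y : Y.carrier => ∀ h ∈ H, h • y = y)))
  constructor
  · exact fun hx => ⟨fun h hh => congrArg Prod.fst (hx h hh),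
      fun h hh => congrArg Prod.snd (hx h hh)⟩
  · exact fun hx h hh => Prod.ext (hx.1 h hh) (hx.2 h hh)

theorem fixedCard_point (H : Subgroup G) : fixedCard H (point G) = 1 := by
  rw [fixedCard, Nat.card_eq_one_iff_unique]
  exact ⟨⟨fun _ _ => Subtype.ext rfl⟩, ⟨⟨PUnit.unit, fun _ _ => rfl⟩⟩⟩

theorem fixed_mk_iff (K H : Subgroup G) (g : G) :
    (∀ k ∈ K, k • (g : G ⧸ H) = g) ↔ K ≤ MulAut.conj g • H := by
  refine forall₂_congr fun k _ => ?_
  rw [mem_conj_iff, ← H.inv_mem_iff, MulAction.Quotient.smul_mk, QuotientGroup.eq]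
  simp [mul_assoc]

theorem exists_of_fixedCard_ne_zero [Finite G] {K H : Subgroup G}
    (h : fixedCard K (orbit H) ≠ 0) : ∃ g : G, K ≤ MulAut.conj g • H := by
  rw [fixedCard, ← Nat.pos_iff_ne_zero, Nat.card_pos_iff] at h
  obtain ⟨⟨x, hx⟩⟩ := h.1
  induction x using QuotientGroup.induction_on with
  | H g => exact ⟨g, (fixed_mk_iff K H g).1 hx⟩

theorem fixedCard_self_ne_zero [Finite G] (H : Subgroup G) : fixedCard H (orbit H) ≠ 0 := by
  rw [fixedCard, ← Nat.pos_iff_ne_zero, Nat.card_pos_iff]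
  refine ⟨⟨⟨((1 : G) : G ⧸ H), (fixed_mk_iff H H 1).2 (by simp)⟩⟩, inferInstance⟩

theorem orbit_iso_conj [Finite G] (g : G) (H : Subgroup G) :
    Iso (orbit H) (orbit (MulAut.conj g • H)) := by
  refine ⟨Quotient.congr (Equiv.mulRight g⁻¹) fun a b => ?_, ?_⟩
  · rw [QuotientGroup.leftRel_apply, QuotientGroup.leftRel_apply, mem_conj_iff]
    simp [mul_assoc]
  · intro x y
    induction y using QuotientGroup.induction_on with
    | H y => exact congrArg QuotientGroup.mk (mul_assoc x y g⁻¹)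

end FinGSet

namespace BurnsideRing

variable {G : Type u} [Group G]

/-- The mark homomorphism `A_ℚ(G) → C(Sub(G)/G, ℚ)`, sending a finite `G`-set `T` to the function
`(H) ↦ |T^H|`. -/
noncomputable def marks (G : Type u) [Group G] : BurnsideRing G →ₐ[ℚ] (ConjSub G → ℚ) :=
  liftAlgHom
    { toFun := Quotient.lift (fun X => Quotient.lift (fun H => (FinGSet.fixedCard H X : ℚ)) (by
          rintro H _ ⟨g, rfl⟩
          rw [FinGSet.fixedCard_conj])) (by
        rintro X Y h
        funext c
        induction c using Quotient.inductionOn with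
        | h H => exact congrArg Nat.cast (FinGSet.fixedCard_iso H h))
      map_one' := by
        funext c
        induction c using Quotient.inductionOn with
        | h H => exact (congrArg Nat.cast (FinGSet.fixedCard_point H)).trans Nat.cast_one
      map_mul' := by
        rintro ⟨X⟩ ⟨Y⟩
        funext c
        induction c using Quotient.inductionOn with
        | h H =>
          exact (congrArg Nat.cast (FinGSet.fixedCard_prod H X Y)).trans (Nat.cast_mul _ _) }
    (by
      intro X Y
      funext c
      induction c using Quotient.inductionOn with
      | h H => exact (congrArg Nat.cast (FinGSet.fixedCard_sum H X Y)).trans (Nat.cast_add _ _))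

theorem marks_mk (X : FinGSet G) (H : Subgroup G) :
    marks G (mk X) (ConjSub.mk H) = FinGSet.fixedCard H X :=
  congrFun (liftAlgHom_mk _ _ X) _

theorem card_lt_of_marks_ne_zero [Finite G] {H K : Subgroup G}
    (h : marks G (mk (FinGSet.orbit H)) (ConjSub.mk K) ≠ 0)
    (hne : ConjSub.mk K ≠ ConjSub.mk H) : Nat.card K < Nat.card H := by
  rw [marks_mk, Nat.cast_ne_zero] at h
  obtain ⟨g, hg⟩ := FinGSet.exists_of_fixedCard_ne_zero h
  have hc : Nat.card (MulAut.conj g • H : Subgroup G) = Nat.card H :=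
    (Nat.card_congr (Subgroup.equivSMul (MulAut.conj g) H).toEquiv).symm
  rw [← hc]
  refine lt_of_le_of_ne (Subgroup.card_le_of_le hg) fun he => hne ?_
  exact (Quotient.sound ⟨g, Subgroup.eq_of_le_of_card_ge hg he.ge⟩ :
    ConjSub.mk H = ConjSub.mk K).symm

open Classical in
theorem single_mem_range [Finite G] (n : ℕ) : ∀ H : Subgroup G, Nat.card H = n →
    (Pi.single (ConjSub.mk H) 1 : ConjSub G → ℚ) ∈ LinearMap.range (marks G).toLinearMap := by
  induction n using Nat.strong_induction_on with
  | _ n ih =>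
    rintro H rfl
    have := Fintype.ofFinite (ConjSub G)
    set f : ConjSub G → ℚ := marks G (mk (FinGSet.orbit H)) with hf
    have hH : f (ConjSub.mk H) ≠ 0 := by
      rw [hf, marks_mk, Nat.cast_ne_zero]
      exact FinGSet.fixedCard_self_ne_zero H
    have hsum : f = f (ConjSub.mk H) • (Pi.single (ConjSub.mk H) 1 : ConjSub G → ℚ)
        + ∑ c ∈ Finset.univ.erase (ConjSub.mk H), f c • (Pi.single c 1 : ConjSub G → ℚ) := by
      rw [Finset.add_sum_erase _ (fun c => f c • (Pi.single c 1 : ConjSub G → ℚ))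
        (Finset.mem_univ _)]
      funext c
      simp [Finset.sum_apply, Pi.single_apply]
    have hrest : ∑ c ∈ Finset.univ.erase (ConjSub.mk H), f c • (Pi.single c 1 : ConjSub G → ℚ) ∈
        LinearMap.range (marks G).toLinearMap := by
      refine Submodule.sum_mem _ fun c hc => ?_
      by_cases h0 : f c = 0
      · rw [h0, zero_smul]
        exact Submodule.zero_mem _
      · refine Submodule.smul_mem _ _ ?_
        induction c using Quotient.inductionOn with
        | h K => exact ih _ (card_lt_of_marks_ne_zero h0 (Finset.ne_of_mem_erase hc)) K rfl
    have hfm : f ∈ LinearMap.range (marks G).toLinearMap :=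
      ⟨mk (FinGSet.orbit H), rfl⟩
    rw [← Submodule.smul_mem_iff _ hH, ← Submodule.add_mem_iff_left _ hrest, ← hsum]
    exact hfm

theorem marks_surjective [Finite G] : Function.Surjective (marks G) := by
  classical
  have := Fintype.ofFinite (ConjSub G)
  intro f
  have hf : f = ∑ c, f c • (Pi.single c 1 : ConjSub G → ℚ) := by
    funext c
    simp [Finset.sum_apply, Pi.single_apply]
  have : f ∈ LinearMap.range (marks G).toLinearMap := by
    rw [hf]
    refine Submodule.sum_mem _ fun c _ => Submodule.smul_mem _ _ ?_
    induction c using Quotient.inductionOn with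
    | h K => exact single_mem_range _ K rfl
  obtain ⟨a, ha⟩ := this
  exact ⟨a, ha⟩

/-- The span of the classes of transitive `G`-sets. -/
noncomputable def orbitSpan (G : Type u) [Group G] [Finite G] : Submodule ℚ (BurnsideRing G) :=
  Submodule.span ℚ (Set.range fun c : ConjSub G => mk (FinGSet.orbit c.out))

theorem mk_orbit_mem [Finite G] (H : Subgroup G) : mk (FinGSet.orbit H) ∈ orbitSpan G := by
  obtain ⟨g, hg⟩ : (ConjSub.mk H).out ≈ H := Quotient.mk_out H
  refine Submodule.subset_span ⟨ConjSub.mk H, (mk_iso ?_).symm⟩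
  have := FinGSet.orbit_iso_conj g (ConjSub.mk H).out
  rw [← hg] at this
  exact (FinGSet.isoSetoid G).symm this

theorem mk_mem [Finite G] (n : ℕ) : ∀ X : FinGSet G, Nat.card X.carrier = n →
    mk X ∈ orbitSpan G := by
  classical
  induction n using Nat.strong_induction_on with
  | _ n ih =>
    rintro X rfl
    rcases isEmpty_or_nonempty X.carrier with hX | ⟨⟨x⟩⟩
    · have h : mk (FinGSet.sum X X) = mk X :=
        mk_iso ⟨Equiv.emptySum X.carrier X.carrier, fun g y => by
          rcases y with y | y
          · exact (hX.false y).elim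
          · rfl⟩
      rw [mk_sum, add_eq_left] at h
      rw [h]
      exact Submodule.zero_mem _
    · have hinv : ∀ (g : G) (y : X.carrier), y ∈ (MulAction.orbit G x)ᶜ →
          g • y ∈ (MulAction.orbit G x)ᶜ := fun g y hy h =>
        hy (by simpa using MulAction.mem_orbit_of_mem_orbit g⁻¹ h)
      let Y : FinGSet G :=
        { carrier := ((MulAction.orbit G x)ᶜ : Set X.carrier)
          action :=
            { smul := fun g y => ⟨g • y.1, hinv g y.1 y.2⟩
              one_smul := fun y => Subtype.ext (one_smul G y.1)
              mul_smul := fun g h y => Subtype.ext (mul_smul g h y.1) } }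
      have h : mk X = mk (FinGSet.orbit (MulAction.stabilizer G x)) + mk Y := by
        rw [← mk_sum]
        refine mk_iso ((FinGSet.isoSetoid G).symm ⟨(Equiv.sumCongr
          (MulAction.orbitEquivQuotientStabilizer G x).symm (Equiv.refl _)).trans
          (Equiv.Set.sumCompl (MulAction.orbit G x)), ?_⟩)
        rintro g (y | y)
        · induction y using QuotientGroup.induction_on with
          | H y => exact mul_smul g y x
        · rfl
      rw [h]
      refine Submodule.add_mem _ (mk_orbit_mem _) (ih _ ?_ Y rfl)
      exact Finite.card_subtype_lt (x := x) (fun hx => hx (MulAction.mem_orbit_self x))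

theorem orbitSpan_eq_top [Finite G] : orbitSpan G = ⊤ := by
  rw [eq_top_iff]
  rintro a -
  obtain ⟨a, rfl⟩ := Ideal.Quotient.mk_surjective a
  induction a using MonoidAlgebra.induction_on with
  | of c =>
    induction c using Quotient.inductionOn with
    | h X => exact mk_mem _ X rfl
  | add a b ha hb =>
    rw [map_add]
    exact Submodule.add_mem _ ha hb
  | smul r a ha => exact Submodule.smul_mem _ r ha

theorem marks_bijective [Finite G] : Function.Bijective (marks G) := by
  classical
  have := Fintype.ofFinite (ConjSub G)
  refine ⟨?_, marks_surjective⟩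
  have : Module.Finite ℚ (BurnsideRing G) :=
    ⟨⟨(Set.range fun c : ConjSub G => mk (FinGSet.orbit c.out)).toFinset, by
      rw [Set.coe_toFinset]
      exact orbitSpan_eq_top⟩⟩
  have hle : Module.finrank ℚ (BurnsideRing G) ≤ Fintype.card (ConjSub G) := by
    have := finrank_range_le_card (R := ℚ) (fun c : ConjSub G => mk (FinGSet.orbit c.out))
    rwa [Set.finrank, show Submodule.span ℚ _ = (⊤ : Submodule ℚ (BurnsideRing G)) from
      orbitSpan_eq_top, finrank_top] at this
  have hge := LinearMap.finrank_le_finrank_of_surjective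
    (f := (marks G).toLinearMap) marks_surjective
  rw [Module.finrank_fintype_fun_eq_card] at hge
  exact (LinearMap.injective_iff_surjective_of_finrank_eq_finrank
    (f := (marks G).toLinearMap) (by
      rw [Module.finrank_fintype_fun_eq_card]; exact le_antisymm hle hge)).2 marks_surjective

/-- tom Dieck's isomorphism `A_ℚ(G) ≅ C(Sub(G)/G, ℚ)`. -/
noncomputable def tomDieck (G : Type u) [Group G] [Finite G] :
    BurnsideRing G ≃ₐ[ℚ] (ConjSub G → ℚ) :=
  AlgEquiv.ofBijective (marks G) marks_bijective

open Classical in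
/-- The idempotent `e_H^G ∈ A_ℚ(G)` corresponding to the characteristic function of `(H)`. -/
noncomputable def idem [Finite G] (H : Subgroup G) : BurnsideRing G :=
  (tomDieck G).symm (Pi.single (ConjSub.mk H) 1)

end BurnsideRing

/-! ### The action of Burnside rings on a Mackey functor -/

namespace MackeyFunctor

variable {G : Type u} [Group G] (M : MackeyFunctor.{u, v} G)

/-- For `S ≤ K`, the operator `I_S^K ∘ R_S^K` on `M(G/K)`. -/
def indRes (K : Subgroup G) (S : Subgroup K) : Module.End ℚ (M.obj K) :=
  M.ind (Subgroup.map_subtype_le S) ∘ₗ M.res (Subgroup.map_subtype_le S)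

/-- The operator on `M(G/K)` given by a finite `K`-set `X`. It is the sum over the orbits of `X` of
`I_S^K ∘ R_S^K`, where `S` is the stabilizer of a point of the orbit; the sum is written as one over
all points of `X`, weighted by the inverse length `|S| / |K|` of the orbit. -/
noncomputable def setAct (K : Subgroup G) (X : FinGSet K) : Module.End ℚ (M.obj K) :=
  letI := Fintype.ofFinite X.carrier
  ∑ x : X.carrier, ((Nat.card (MulAction.stabilizer K x) : ℚ) / Nat.card K) •
    M.indRes K (MulAction.stabilizer K x)

theorem setAct_iso (K : Subgroup G) {X Y : FinGSet K} (h : FinGSet.Iso X Y) :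
    M.setAct K X = M.setAct K Y := by
  obtain ⟨f, hf⟩ := h
  let _ := Fintype.ofFinite X.carrier
  let _ := Fintype.ofFinite Y.carrier
  refine Fintype.sum_equiv f _ _ fun x => ?_
  have : MulAction.stabilizer K x = MulAction.stabilizer K (f x) := by
    ext k
    rw [MulAction.mem_stabilizer_iff, MulAction.mem_stabilizer_iff, ← hf, f.apply_eq_iff_eq]
  rw [this]

theorem setAct_sum (K : Subgroup G) (X Y : FinGSet K) :
    M.setAct K (FinGSet.sum X Y) = M.setAct K X + M.setAct K Y := by
  let _ := Fintype.ofFinite X.carrier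
  let _ := Fintype.ofFinite Y.carrier
  let T (S : Subgroup K) : Module.End ℚ (M.obj K) :=
    ((Nat.card S : ℚ) / Nat.card K) • M.indRes K S
  have h1 : M.setAct K (FinGSet.sum X Y) = ∑ z : X.carrier ⊕ Y.carrier,
      T (MulAction.stabilizer K (z : (FinGSet.sum X Y).carrier)) :=
    @Fintype.sum_equiv (FinGSet.sum X Y).carrier (X.carrier ⊕ Y.carrier) _
      (Fintype.ofFinite _) _ _ (Equiv.refl _) _ _ fun _ => rfl
  rw [h1, Fintype.sum_sum_type]
  refine congrArg₂ (· + ·) (Finset.sum_congr rfl fun x _ => congrArg T ?_)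
    (Finset.sum_congr rfl fun y _ => congrArg T ?_)
  · ext k
    exact Sum.inl_injective.eq_iff (α := X.carrier) (β := X.carrier ⊕ Y.carrier) (a := k • x)
  · ext k
    exact Sum.inr_injective.eq_iff (α := Y.carrier) (β := X.carrier ⊕ Y.carrier) (a := k • y)

/-- The linear extension of `setAct` to formal combinations of finite `K`-sets. -/
noncomputable def preAct (K : Subgroup G) : ℚ[IsoClass K] →ₗ[ℚ] Module.End ℚ (M.obj K) :=
  Finsupp.linearCombination ℚ (Quotient.lift (M.setAct K) fun _ _ h => M.setAct_iso K h) ∘ₗ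
    (MonoidAlgebra.coeffLinearEquiv ℚ).toLinearMap

theorem preAct_single (K : Subgroup G) (X : FinGSet K) (r : ℚ) :
    M.preAct K (MonoidAlgebra.single (IsoClass.mk X) r) = r • M.setAct K X := by
  exact Finsupp.linearCombination_single ℚ r (IsoClass.mk X)

theorem preAct_eq_zero (K : Subgroup G) (a : ℚ[IsoClass K])
    (ha : a ∈ Ideal.span (burnsideRel K)) : M.preAct K a = 0 := by
  suffices h : ∀ r : ℚ[IsoClass K], M.preAct K (r * a) = 0 by simpa using h 1
  induction ha using Submodule.span_induction with
  | mem a ha =>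
    obtain ⟨X, Y, rfl⟩ := ha
    intro r
    induction r using MonoidAlgebra.induction_on with
    | of c =>
      induction c using Quotient.inductionOn with
      | h Z =>
        have hZ : FinGSet.Iso (FinGSet.prod Z (FinGSet.sum X Y))
            (FinGSet.sum (FinGSet.prod Z X) (FinGSet.prod Z Y)) := by
          refine ⟨Equiv.prodSumDistrib Z.carrier X.carrier Y.carrier, ?_⟩
          rintro g ⟨z, x | y⟩ <;> rfl
        change M.preAct K (MonoidAlgebra.single (IsoClass.mk Z) 1 * _) = 0
        rw [mul_sub, mul_sub, MonoidAlgebra.single_mul_single, MonoidAlgebra.single_mul_single,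
          MonoidAlgebra.single_mul_single, IsoClass.mk_mul, IsoClass.mk_mul, IsoClass.mk_mul,
          map_sub, map_sub, preAct_single, preAct_single, preAct_single, setAct_iso M K hZ,
          setAct_sum]
        simp
    | add r s hr hs => rw [add_mul, map_add, hr, hs, add_zero]
    | smul q r hr => rw [smul_mul_assoc, map_smul, hr, smul_zero]
  | zero => intro r; simp
  | add a b _ _ ha hb => intro r; rw [mul_add, map_add, ha, hb, add_zero]
  | smul s a _ ha => intro r; rw [smul_eq_mul, ← mul_assoc, ha]

/-- The action of the rational Burnside ring `A_ℚ(K)` on `M(G/K)`, the linear extension of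
`[K/S] ↦ I_S^K ∘ R_S^K`. -/
noncomputable def burnsideAct (K : Subgroup G) : BurnsideRing K →ₗ[ℚ] Module.End ℚ (M.obj K) :=
  Submodule.liftQ ((Ideal.span (burnsideRel K)).restrictScalars ℚ) (M.preAct K)
    fun a ha => M.preAct_eq_zero K a ha

theorem burnsideAct_mk (K : Subgroup G) (X : FinGSet K) :
    M.burnsideAct K (BurnsideRing.mk X) = M.setAct K X :=
  (M.preAct_single K X 1).trans (one_smul _ _)

theorem ind_res_conj (K : Subgroup G) {S T : Subgroup G} (hS : S ≤ K) (hT : T ≤ K) (g : G)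
    (hg : g ∈ K) (e : T = MulAut.conj g • S) (m : M.obj K) :
    M.ind hT (M.res hT m) = M.ind hS (M.res hS m) := by
  have eK : K = MulAut.conj g • K := (Subgroup.conj_smul_eq_self_of_mem hg).symm
  have h1 := M.res_conj g hS hT e eK m
  rw [M.conj_self g hg] at h1
  rw [h1, M.ind_conj g hS hT e eK, M.conj_self g hg]

/-- The class `[K/S]` acts as `I_S^K ∘ R_S^K`. -/
theorem burnsideAct_orbit [Finite G] (K : Subgroup G) (S : Subgroup K) :
    M.burnsideAct K (BurnsideRing.mk (FinGSet.orbit S)) = M.indRes K S := by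
  rw [burnsideAct_mk]
  let _ := Fintype.ofFinite (FinGSet.orbit S).carrier
  have key : ∀ x : (FinGSet.orbit S).carrier,
      ((Nat.card (MulAction.stabilizer K x) : ℚ) / Nat.card K) •
        M.indRes K (MulAction.stabilizer K x) =
      ((Nat.card S : ℚ) / Nat.card K) • M.indRes K S := by
    intro x
    induction x using QuotientGroup.induction_on with
    | H k =>
      have hs : MulAction.stabilizer K ((k : K ⧸ S)) = MulAut.conj k • S := by
        ext a
        rw [MulAction.mem_stabilizer_iff, mem_conj_iff, ← S.inv_mem_iff,
          MulAction.Quotient.smul_mk, QuotientGroup.eq]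
        simp [mul_assoc]
      have hc : Nat.card (MulAut.conj k • S : Subgroup K) = Nat.card S :=
        (Nat.card_congr (Subgroup.equivSMul (MulAut.conj k) S).toEquiv).symm
      change ((Nat.card (MulAction.stabilizer K (k : K ⧸ S)) : ℚ) / Nat.card K) •
        M.indRes K (MulAction.stabilizer K (k : K ⧸ S)) = _
      rw [hs, hc]
      congr 1
      ext m
      refine M.ind_res_conj K _ _ (k : G) k.2 ?_ m
      ext a
      rw [mem_conj_iff, Subgroup.mem_map, Subgroup.mem_map]
      constructor
      · rintro ⟨b, hb, rfl⟩
        exact ⟨_, mem_conj_iff.1 hb, rfl⟩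
      · rintro ⟨b, hb, hab⟩
        refine ⟨k * b * k⁻¹, mem_conj_iff.2 (by simpa [mul_assoc] using hb), ?_⟩
        have hab' : (b : G) = (k : G)⁻¹ * a * k := hab
        simp [hab', mul_assoc]
  rw [setAct, Finset.sum_congr rfl fun x _ => key x, Finset.sum_const, ← Nat.cast_smul_eq_nsmul ℚ,
    smul_smul, Finset.card_univ, ← Nat.card_eq_fintype_card]
  have hcard : Nat.card K = Nat.card (K ⧸ S) * Nat.card S := S.card_eq_card_quotient_mul_card_subgroup
  have hpos : (Nat.card K : ℚ) ≠ 0 := Nat.cast_ne_zero.2 Nat.card_pos.ne'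
  have : (Nat.card (FinGSet.orbit S).carrier : ℚ) * ((Nat.card S : ℚ) / Nat.card K) = 1 := by
    rw [← mul_div_assoc, div_eq_one_iff_eq hpos, hcard, Nat.cast_mul]
    rfl
  rw [this, one_smul]

/-- `M = e_H^G M`, that is, `R_K^G(e_H^G) M(G/K) = M(G/K)` for all subgroups `K` of `G`. -/
def IsIdemPart [Finite G] (H : Subgroup G) : ObjectProperty (MackeyFunctor.{u, v} G) := fun M =>
  ∀ K : Subgroup G, LinearMap.range (M.burnsideAct K (BurnsideRing.res K (BurnsideRing.idem H))) = ⊤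

/-- The full subcategory `e_H^G Mack_ℚ(G)`. -/
abbrev IdemMackey [Finite G] (H : Subgroup G) := (IsIdemPart.{u, v} H).FullSubcategory

end MackeyFunctor

/-! ### Evaluation at `G/H` and the functor `F_H` -/

/-- The Weyl group `W_G H = N_G H / H`. -/
abbrev WeylGroup {G : Type u} [Group G] (H : Subgroup G) : Type u :=
  Subgroup.normalizer (H : Set G) ⧸ H.subgroupOf (Subgroup.normalizer (H : Set G))

theorem conj_eq_of_mem_normalizer {G : Type u} [Group G] {H : Subgroup G} {n : G}
    (hn : n ∈ Subgroup.normalizer (H : Set G)) : H = MulAut.conj n • H := by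
  ext x
  rw [mem_conj_iff]
  have := Subgroup.mem_normalizer_iff.1 (inv_mem hn) x
  simpa using this

namespace MackeyFunctor

variable {G : Type u} [Group G]

/-- The representation of `W_G H` on `M(G/H)`, in which the class of `n` acts as `C_n`. -/
def weylRep (M : MackeyFunctor.{u, v} G) (H : Subgroup G) :
    Representation ℚ (WeylGroup H) (M.obj H) :=
  QuotientGroup.lift (H.subgroupOf (Subgroup.normalizer (H : Set G)))
    { toFun := fun n => M.conj (n : G) (conj_eq_of_mem_normalizer n.2)
      map_one' := by
        ext m
        exact M.conj_self 1 H.one_mem _ m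
      map_mul' := fun a b => by
        ext m
        exact M.conj_mul (a : G) (b : G) _ _ _ m }
    (by
      intro n hn
      ext m
      exact M.conj_self (n : G) (Subgroup.mem_subgroupOf.1 hn) _ m)

/-- Evaluation at `G/H`, as a functor to representations of `W_G H`. -/
def evalRep (H : Subgroup G) : MackeyFunctor.{u, v} G ⥤ Rep.{v} ℚ (WeylGroup H) where
  obj M := Rep.of (M.weylRep H)
  map {M N} f := Rep.ofHom
    { f.app H with
      isIntertwining' := by
        intro w
        induction w using QuotientGroup.induction_on with
        | H n =>
          ext m
          exact f.app_conj (n : G) _ m }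

/-- Evaluation at `G/H`, `M ↦ M(G/H)`, as a functor to `ℚ[W_G H]`-modules. -/
noncomputable def eval (H : Subgroup G) :
    MackeyFunctor.{u, v} G ⥤ ModuleCat.{v} ℚ[WeylGroup H] :=
  evalRep H ⋙ Rep.toModuleMonoidAlgebra

/-- The functor `U_H : e_H^G Mack_ℚ(G) ⥤ ℚ[W_G H]-mod`, `M ↦ M(G/H)`. -/
noncomputable def U [Finite G] (H : Subgroup G) :
    IdemMackey.{u, v} H ⥤ ModuleCat.{v} ℚ[WeylGroup H] :=
  ObjectProperty.ι _ ⋙ eval H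

/-- The set `(G/K)^H` of `H`-fixed points of `G/K`. -/
abbrev FixPts (H K : Subgroup G) : Type u := {σ : G ⧸ K // ∀ h ∈ H, h • σ = σ}

namespace FixPts

variable {H : Subgroup G}

/-- The left action of `n ∈ N_G H` on `(G/K)^H`. -/
def lmul {K : Subgroup G} (n : Subgroup.normalizer (H : Set G)) (σ : FixPts H K) : FixPts H K :=
  ⟨(n : G) • σ.1, fun h hh => by
    have h1 : (n : G)⁻¹ * h * n ∈ H := by
      rw [← mem_conj_iff, ← conj_eq_of_mem_normalizer n.2]
      exact hh
    have h2 := σ.2 _ h1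
    rwa [mul_assoc, mul_smul, inv_smul_eq_iff, mul_smul] at h2⟩

/-- The map `(G/K)^H → (G/A)^H` induced by the projection `G/K → G/A`, for `K ≤ A`. -/
def proj {K A : Subgroup G} (hKA : K ≤ A) (σ : FixPts H K) : FixPts H A :=
  ⟨Subgroup.quotientMapOfLE hKA σ.1, fun h hh => by
    obtain ⟨σ, hσ⟩ := σ
    induction σ using QuotientGroup.induction_on with
    | H g => exact congrArg (Subgroup.quotientMapOfLE hKA) (hσ h hh)⟩

/-- For `K' = g K g⁻¹`, the map `(G/K')^H → (G/K)^H` induced by the `G`-map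
`G/K' → G/K`, `x K' ↦ x g K`. -/
def rmul (g : G) {K K' : Subgroup G} (e : K' = MulAut.conj g • K) (σ : FixPts H K') :
    FixPts H K :=
  ⟨Quotient.map' (s₁ := QuotientGroup.leftRel K') (s₂ := QuotientGroup.leftRel K) (· * g)
    (fun a b hab => by
      rw [QuotientGroup.leftRel_apply] at hab ⊢
      rw [e, mem_conj_iff] at hab
      simpa [mul_assoc] using hab) σ.1, fun h hh => by
    obtain ⟨σ, hσ⟩ := σ
    induction σ using QuotientGroup.induction_on with
    | H x =>
      have h1 := hσ h hh
      rw [MulAction.Quotient.smul_mk, QuotientGroup.eq, e, mem_conj_iff] at h1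
      change h • ((x * g : G) : G ⧸ K) = ((x * g : G) : G ⧸ K)
      rw [MulAction.Quotient.smul_mk, QuotientGroup.eq]
      simpa [mul_assoc] using h1⟩

/-- The point of `(G/K)^H` given by an element `g`. -/
def mk {K : Subgroup G} (g : G) (hg : ∀ h ∈ H, h • (g : G ⧸ K) = g) : FixPts H K := ⟨g, hg⟩

theorem exists_mk {K : Subgroup G} (σ : FixPts H K) : ∃ g hg, σ = mk g hg := by
  obtain ⟨σ, hσ⟩ := σ
  induction σ using QuotientGroup.induction_on with
  | H g => exact ⟨g, hσ, rfl⟩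

theorem eq_iff {K : Subgroup G} {σ τ : FixPts H K} (a b : G) (ha : σ.1 = a) (hb : τ.1 = b) :
    σ = τ ↔ a⁻¹ * b ∈ K := by
  rw [← QuotientGroup.eq, Subtype.ext_iff, ha, hb]

theorem proj_lmul {K A : Subgroup G} (hKA : K ≤ A) (n : Subgroup.normalizer (H : Set G))
    (σ : FixPts H K) : proj hKA (lmul n σ) = lmul n (proj hKA σ) := by
  obtain ⟨g, hg, rfl⟩ := exists_mk σ
  rfl

theorem rmul_lmul (g : G) {K K' : Subgroup G} (e : K' = MulAut.conj g • K)
    (n : Subgroup.normalizer (H : Set G)) (σ : FixPts H K') :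
    rmul g e (lmul n σ) = lmul n (rmul g e σ) := by
  obtain ⟨x, hx, rfl⟩ := exists_mk σ
  rw [eq_iff (n * x * g) (n * (x * g)) rfl rfl]
  simp [mul_assoc]

theorem proj_rmul (g : G) {K A K' A' : Subgroup G} (h : K ≤ A) (h' : K' ≤ A')
    (eK : K' = MulAut.conj g • K) (eA : A' = MulAut.conj g • A) (σ : FixPts H K') :
    proj h (rmul g eK σ) = rmul g eA (proj h' σ) := by
  obtain ⟨x, hx, rfl⟩ := exists_mk σ
  rfl

theorem rmul_injective (g : G) {K K' : Subgroup G} (e : K' = MulAut.conj g • K) :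
    Function.Injective (rmul (H := H) g e) := by
  intro σ τ h
  obtain ⟨x, hx, rfl⟩ := exists_mk σ
  obtain ⟨y, hy, rfl⟩ := exists_mk τ
  rw [eq_iff (x * g) (y * g) rfl rfl] at h
  rw [eq_iff x y rfl rfl, e, mem_conj_iff]
  simpa [mul_assoc] using h

theorem rmul_surjective (g : G) {K K' : Subgroup G} (e : K' = MulAut.conj g • K) :
    Function.Surjective (rmul (H := H) g e) := by
  intro σ
  have e' : K = MulAut.conj g⁻¹ • K' := by
    rw [e, smul_smul, ← map_mul, inv_mul_cancel, map_one, one_smul]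
  refine ⟨rmul g⁻¹ e' σ, ?_⟩
  obtain ⟨x, hx, rfl⟩ := exists_mk σ
  rw [eq_iff (x * g⁻¹ * g) x rfl rfl]
  simp

theorem lmul_bijective {K : Subgroup G} (n : Subgroup.normalizer (H : Set G)) :
    Function.Bijective (lmul (H := H) (K := K) n) := by
  refine ⟨fun σ τ h => ?_, fun σ => ⟨lmul n⁻¹ σ, ?_⟩⟩
  · exact Subtype.ext (smul_left_cancel (n : G) (congrArg Subtype.val h))
  · exact Subtype.ext (smul_inv_smul (n : G) σ.1)

end FixPts

section FreeFunctor

variable {H : Subgroup G}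

/-- The value at `G/K` of `F_H V`: the invariants `(⨁_{σ ∈ (G/K)^H} V)^{W_G H}`, that is,
`(ℚ[(G/K)^H] ⊗ V)^{W_G H}`, written as families `y` of elements of `V` indexed by `(G/K)^H` with
`y (n σ) = n (y σ)` for all `n ∈ N_G H`. -/
def freeObj (V : Rep.{v} ℚ (WeylGroup H)) (K : Subgroup G) :
    Submodule ℚ (FixPts H K → V) where
  carrier := {y | ∀ (n : Subgroup.normalizer (H : Set G)) (σ : FixPts H K),
    y (FixPts.lmul n σ) = V.ρ (n : WeylGroup H) (y σ)}
  add_mem' := by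
    intro a b ha hb n σ
    simp [ha n σ, hb n σ]
  zero_mem' := by
    intro n σ
    simp
  smul_mem' := by
    intro c a ha n σ
    simp [ha n σ]

/-- Restriction in `F_H V`: `(R y)_σ = y_{α σ}`, with `α` the projection. -/
def freeRes (V : Rep.{v} ℚ (WeylGroup H)) {K A : Subgroup G} (hKA : K ≤ A) :
    freeObj V A →ₗ[ℚ] freeObj V K where
  toFun y := ⟨fun σ => y.1 (FixPts.proj hKA σ), fun n σ => by
    change y.1 (FixPts.proj hKA (FixPts.lmul n σ)) = _
    rw [FixPts.proj_lmul, y.2]⟩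
  map_add' _ _ := rfl
  map_smul' _ _ := rfl

/-- Conjugation in `F_H V` is induced by the `G`-map `G/gKg⁻¹ → G/K`, `x (g K g⁻¹) ↦ x g K`. -/
def freeConj (V : Rep.{v} ℚ (WeylGroup H)) (g : G) {K K' : Subgroup G}
    (e : K' = MulAut.conj g • K) : freeObj V K →ₗ[ℚ] freeObj V K' where
  toFun y := ⟨fun σ => y.1 (FixPts.rmul g e σ), fun n σ => by
    change y.1 (FixPts.rmul g e (FixPts.lmul n σ)) = _
    rw [FixPts.rmul_lmul, y.2]⟩
  map_add' _ _ := rfl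
  map_smul' _ _ := rfl

noncomputable instance [Finite G] (K : Subgroup G) : Fintype (FixPts H K) := Fintype.ofFinite _

open Classical in
/-- Induction in `F_H V`: `(I y)_τ = ∑_{α σ = τ} y_σ`, with `α` the projection. -/
noncomputable def freeInd [Finite G] (V : Rep.{v} ℚ (WeylGroup H)) {K A : Subgroup G}
    (hKA : K ≤ A) : freeObj V K →ₗ[ℚ] freeObj V A where
  toFun y := ⟨fun τ => ∑ σ with FixPts.proj hKA σ = τ, y.1 σ, fun n τ => by
    rw [map_sum]
    symm
    refine Finset.sum_bij (fun σ _ => FixPts.lmul n σ) ?_ ?_ ?_ ?_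
    · intro σ hσ
      simp only [Finset.mem_filter, Finset.mem_univ, true_and] at hσ ⊢
      rw [FixPts.proj_lmul, hσ]
    · exact fun _ _ _ _ h => (FixPts.lmul_bijective n).1 h
    · intro σ hσ
      obtain ⟨ρ, rfl⟩ := (FixPts.lmul_bijective n).2 σ
      simp only [Finset.mem_filter, Finset.mem_univ, true_and] at hσ
      rw [FixPts.proj_lmul] at hσ
      exact ⟨ρ, by simpa using (FixPts.lmul_bijective n).1 hσ, rfl⟩
    · exact fun σ _ => (y.2 n σ).symm⟩
  map_add' a b := by
    ext τ
    exact Finset.sum_add_distrib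
  map_smul' c a := by
    ext τ
    exact (Finset.smul_sum (r := c) (f := a.1)).symm

open Classical in
theorem freeInd_apply [Finite G] (V : Rep.{v} ℚ (WeylGroup H)) {K A : Subgroup G}
    (hKA : K ≤ A) (y : freeObj V K) (τ : FixPts H A) :
    (freeInd V hKA y).1 τ = ∑ σ with FixPts.proj hKA σ = τ, y.1 σ := rfl

theorem free_mackey [Finite G] (V : Rep.{v} ℚ (WeylGroup H)) {K L A : Subgroup G} (hK : K ≤ A)
    (hL : L ≤ A) (s : Finset G) (hs : IsDoubleCosetReps K A L s) (y : freeObj V L) :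
    freeRes V hK (freeInd V hL y) = ∑ x ∈ s,
      freeInd V (K := K ⊓ MulAut.conj x • L) (A := K) inf_le_left
        (freeConj V x (conj_inf x K L)
          (freeRes V (K := L ⊓ MulAut.conj x⁻¹ • K) (A := L) inf_le_left y)) := by
  classical
  apply Subtype.ext
  funext σ
  rw [AddSubmonoidClass.coe_finsetSum, Finset.sum_apply]
  change ∑ τ with FixPts.proj hL τ = FixPts.proj hK σ, y.1 τ = ∑ x ∈ s,
    ∑ ρ : FixPts H (K ⊓ MulAut.conj x • L) with FixPts.proj inf_le_left ρ = σ,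
      y.1 (FixPts.proj inf_le_left (FixPts.rmul x (conj_inf x K L) ρ))
  rw [Finset.sum_sigma']
  symm
  refine Finset.sum_bij (fun p _ => FixPts.proj inf_le_left
    (FixPts.rmul p.1 (conj_inf p.1 K L) p.2)) ?_ ?_ ?_ ?_
  · rintro ⟨x, ρ⟩ hp
    simp only [Finset.mem_sigma, Finset.mem_filter, Finset.mem_univ, true_and] at hp ⊢
    obtain ⟨hx, rfl⟩ := hp
    obtain ⟨g, hg, rfl⟩ := FixPts.exists_mk ρ
    rw [FixPts.eq_iff (g * x) g rfl rfl]
    simpa [mul_assoc] using hs.1 x hx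
  · rintro ⟨x, ρ⟩ hp ⟨x', ρ'⟩ hp' h
    simp only [Finset.mem_sigma, Finset.mem_filter, Finset.mem_univ, true_and] at hp hp'
    obtain ⟨hx, rfl⟩ := hp
    obtain ⟨hx', hρ⟩ := hp'
    obtain ⟨g, hg, rfl⟩ := FixPts.exists_mk ρ
    obtain ⟨g', hg', rfl⟩ := FixPts.exists_mk ρ'
    rw [FixPts.eq_iff (g * x) (g' * x') rfl rfl] at h
    rw [FixPts.eq_iff g' g rfl rfl] at hρ
    have hxx : x = x' := by
      obtain ⟨z, -, hz⟩ := hs.2 x' (hs.1 x' hx')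
      rw [hz x ⟨hx, g'⁻¹ * g, hρ, (g * x)⁻¹ * (g' * x'), h, by group⟩,
        hz x' ⟨hx', 1, K.one_mem, 1, L.one_mem, by group⟩]
    subst hxx
    have : FixPts.mk g hg = FixPts.mk g' hg' := by
      rw [FixPts.eq_iff g g' rfl rfl, Subgroup.mem_inf, mem_conj_iff]
      refine ⟨?_, ?_⟩
      · simpa using K.inv_mem hρ
      · simpa [mul_assoc] using h
    rw [this]
  · intro τ hτ
    simp only [Finset.mem_filter, Finset.mem_univ, true_and] at hτ
    obtain ⟨t, ht, rfl⟩ := FixPts.exists_mk τ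
    obtain ⟨g, hg, rfl⟩ := FixPts.exists_mk σ
    rw [FixPts.eq_iff t g rfl rfl] at hτ
    have hA : g⁻¹ * t ∈ A := by simpa using A.inv_mem hτ
    obtain ⟨x, ⟨hx, k, hk, l, hl, hkl⟩, -⟩ := hs.2 _ hA
    have ht' : t = g * k * x * l := by
      rw [mul_assoc, mul_assoc, ← mul_assoc k, ← hkl]
      group
    subst ht'
    have hfix : ∀ h ∈ H, h • ((g * k : G) : G ⧸ (K ⊓ MulAut.conj x • L)) = (g * k : G) := by
      intro h hh
      have h1 := hg h hh
      have h2 := ht h hh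
      rw [MulAction.Quotient.smul_mk, QuotientGroup.eq] at h1 h2 ⊢
      rw [Subgroup.mem_inf, mem_conj_iff]
      refine ⟨?_, ?_⟩
      · have := K.mul_mem (K.mul_mem (K.inv_mem hk) h1) hk
        simpa [mul_assoc] using this
      · have := L.mul_mem (L.mul_mem hl h2) (L.inv_mem hl)
        simpa [mul_assoc] using this
    refine ⟨⟨x, FixPts.mk (g * k) hfix⟩, ?_, ?_⟩
    · simp only [Finset.mem_sigma, Finset.mem_filter, Finset.mem_univ, true_and]
      refine ⟨hx, ?_⟩
      rw [FixPts.eq_iff (g * k) g rfl rfl]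
      simpa using hk
    · rw [FixPts.eq_iff (g * k * x) (g * k * x * l) rfl rfl]
      simpa [mul_assoc] using hl
  · exact fun _ _ => rfl

/-- The Mackey functor `F_H V`, for a representation `V` of `W_G H`. -/
noncomputable def free [Finite G] (V : Rep.{v} ℚ (WeylGroup H)) :
    MackeyFunctor.{u, max u v} G where
  obj K := freeObj V K
  res h := freeRes V h
  ind h := freeInd V h
  conj g _ _ e := freeConj V g e
  res_self K y := by
    apply Subtype.ext
    funext σ
    obtain ⟨g, hg, rfl⟩ := FixPts.exists_mk σ
    rfl
  ind_self K y := by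
    classical
    apply Subtype.ext
    funext σ
    rw [freeInd_apply]
    have : ∀ τ : FixPts H K, FixPts.proj le_rfl τ = τ := by
      intro τ
      obtain ⟨g, hg, rfl⟩ := FixPts.exists_mk τ
      rfl
    simp [this, Finset.filter_eq']
  conj_self {K} k hk e y := by
    apply Subtype.ext
    funext σ
    refine congrArg y.1 ?_
    obtain ⟨g, hg, rfl⟩ := FixPts.exists_mk σ
    rw [FixPts.eq_iff (g * k) g rfl rfl]
    simpa using hk
  res_trans h1 h2 y := by
    apply Subtype.ext
    funext σ
    refine congrArg y.1 ?_
    obtain ⟨g, hg, rfl⟩ := FixPts.exists_mk σ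
    rfl
  ind_trans {L K A} h1 h2 y := by
    classical
    apply Subtype.ext
    funext τ
    simp only [freeInd_apply]
    rw [← Finset.sum_fiberwise_of_maps_to (g := FixPts.proj h1)
      (t := Finset.univ.filter fun σ => FixPts.proj h2 σ = τ)]
    · refine Finset.sum_congr rfl fun σ hσ => Finset.sum_congr ?_ fun _ _ => rfl
      ext ρ
      simp only [Finset.mem_filter, Finset.mem_univ, true_and] at hσ ⊢
      refine and_iff_right_of_imp ?_
      rintro rfl
      rw [← hσ]
      obtain ⟨g, hg, rfl⟩ := FixPts.exists_mk ρ
      rfl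
    · intro ρ hρ
      simp only [Finset.mem_filter, Finset.mem_univ, true_and] at hρ ⊢
      rw [← hρ]
      obtain ⟨g, hg, rfl⟩ := FixPts.exists_mk ρ
      rfl
  conj_mul g h _ _ _ e e' e'' y := by
    apply Subtype.ext
    funext σ
    refine congrArg y.1 ?_
    obtain ⟨x, hx, rfl⟩ := FixPts.exists_mk σ
    rw [FixPts.eq_iff (x * (g * h)) (x * g * h) rfl rfl]
    simp [mul_assoc]
  res_conj g _ _ _ _ h h' eK eH y := by
    apply Subtype.ext
    funext σ
    exact congrArg y.1 (FixPts.proj_rmul g h h' eK eH σ).symm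
  ind_conj g K A K' A' h h' eK eA y := by
    classical
    apply Subtype.ext
    funext τ
    change (freeInd V h' (freeConj V g eK y)).1 τ = (freeInd V h y).1 (FixPts.rmul g eA τ)
    rw [freeInd_apply, freeInd_apply]
    refine Finset.sum_bij (fun σ _ => FixPts.rmul g eK σ) ?_ ?_ ?_ ?_
    · intro σ hσ
      simp only [Finset.mem_filter, Finset.mem_univ, true_and] at hσ ⊢
      rw [FixPts.proj_rmul g h h' eK eA, hσ]
    · exact fun _ _ _ _ e => FixPts.rmul_injective g eK e
    · intro σ hσ
      obtain ⟨ρ, rfl⟩ := FixPts.rmul_surjective g eK σ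
      simp only [Finset.mem_filter, Finset.mem_univ, true_and] at hσ
      rw [FixPts.proj_rmul g h h' eK eA] at hσ
      exact ⟨ρ, by simpa using FixPts.rmul_injective g eA hσ, rfl⟩
    · exact fun _ _ => rfl
  mackey hK hL s hs y := free_mackey V hK hL s hs y

/-- The map `F_H V (G/K) → F_H V' (G/K)` induced by a morphism `V → V'`. -/
def freeMap {V V' : Rep.{v} ℚ (WeylGroup H)} (f : V ⟶ V') (K : Subgroup G) :
    freeObj V K →ₗ[ℚ] freeObj V' K where
  toFun y := ⟨fun σ => f.hom (y.1 σ), fun n σ => by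
    change f.hom (y.1 (FixPts.lmul n σ)) = V'.ρ (n : WeylGroup H) (f.hom (y.1 σ))
    rw [y.2, Rep.hom_comm_apply]⟩
  map_add' a b := by
    ext σ
    exact map_add f.hom _ _
  map_smul' c a := by
    ext σ
    exact map_smul f.hom c _

/-- `V ↦ F_H V` as a functor on representations of `W_G H`. -/
noncomputable def freeRep [Finite G] (H : Subgroup G) :
    Rep.{v} ℚ (WeylGroup H) ⥤ MackeyFunctor.{u, max u v} G where
  obj V := free V
  map {V V'} f :=
    { app := freeMap f
      app_res := fun _ _ => rfl
      app_ind := fun h y => by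
        classical
        apply Subtype.ext
        funext τ
        exact map_sum f.hom _ _
      app_conj := fun _ _ _ _ _ => rfl }

/-- The functor `F_H` from `ℚ[W_G H]`-modules to rational `G`-Mackey functors. -/
noncomputable def F [Finite G] (H : Subgroup G) :
    ModuleCat.{v} ℚ[WeylGroup H] ⥤ MackeyFunctor.{u, max u v} G :=
  Rep.ofModuleMonoidAlgebra ⋙ freeRep H

end FreeFunctor

end MackeyFunctor

end RatMackey

/-!
The ring `A_ℚ(G)` acts on every `M(G/K)` compatibly with restriction, induction and conjugation, so
its orthogonal idempotents `e_H` split `Mack_ℚ(G)` as the product of the `e_H Mack_ℚ(G)`.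

If `M = e_H M`, then `M` is controlled by its value at `G/H`. Indeed `[G/H]` acts on `M` by the
nonzero scalar `|(G/H)^H|`, so `M(G/K)` vanishes unless `K` contains a conjugate of `H`, and is
detected by the restrictions to, and generated by the inductions from, the conjugates of `H`
contained in `K`. Conversely, a Mackey functor that is detected in this way satisfies `M = e_H M`,
and `F_H V` is one. Consequently, in the double coset formula all terms through proper subgroups of
conjugates of `H` vanish, a family of maps that commutes with restrictions and conjugations
automatically commutes with inductions, and a morphism is an isomorphism as soon as it is one at
`G/H`. At `G/H`, the unit and the counit of the equivalence are governed by evaluation at the point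
`H` of `(G/H)^H`, which generates `(G/H)^H` freely under `W_G H`.
-/

namespace RatMackey

/-! ### Conjugate subgroups and double cosets -/

section Subgroups

variable {G : Type u} [Group G]

theorem card_conj_smul (g : G) (K : Subgroup G) :
    Nat.card (MulAut.conj g • K : Subgroup G) = Nat.card K :=
  (Nat.card_congr (Subgroup.equivSMul (MulAut.conj g) K).toEquiv).symm

theorem cast_card_ne_zero [Finite G] (K : Subgroup G) : (Nat.card K : ℚ) ≠ 0 :=
  Nat.cast_ne_zero.2 Nat.card_pos.ne'

theorem conj_smul_eq_of_le [Finite G] {H : Subgroup G} {g g' : G}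
    (h : MulAut.conj g' • H ≤ MulAut.conj g • H) : MulAut.conj g' • H = MulAut.conj g • H :=
  Subgroup.eq_of_le_of_card_ge h (by rw [card_conj_smul, card_conj_smul])

theorem stabilizer_quotientGroup_mk (H : Subgroup G) (g : G) :
    MulAction.stabilizer G (g : G ⧸ H) = MulAut.conj g • H := by
  rw [← mul_one g, ← smul_eq_mul, ← MulAction.Quotient.smul_mk,
    MulAction.stabilizer_smul_eq_stabilizer_map_conj, smul_eq_mul, mul_one]
  exact congrArg (MulAut.conj g • ·) (MulAction.stabilizer_quotient H)

theorem exists_isDoubleCosetReps [Finite G] {K H L : Subgroup G} (hK : K ≤ H) (hL : L ≤ H) :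
    ∃ s : Finset G, IsDoubleCosetReps K H L s := by
  classical
  let Q := DoubleCoset.Quotient (K.subgroupOf H : Set H) (L.subgroupOf H)
  have : Finite Q := Quotient.finite _
  have := Fintype.ofFinite Q
  refine ⟨Finset.univ.image fun q : Q => (q.out : G), fun x hx => ?_, fun h hh => ?_⟩
  · obtain ⟨q, -, rfl⟩ := Finset.mem_image.1 hx
    exact q.out.2
  · obtain ⟨k, l, hk, hl, e⟩ := DoubleCoset.mk_out_eq_mul (K.subgroupOf H) (L.subgroupOf H) ⟨h, hh⟩
    refine ⟨_, ⟨Finset.mem_image_of_mem _ (Finset.mem_univ (DoubleCoset.mk _ _ ⟨h, hh⟩)),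
      _, K.inv_mem hk, _, L.inv_mem hl, by simp [e, mul_assoc]⟩, ?_⟩
    rintro _ ⟨hx, k', hk', l', hl', e'⟩
    obtain ⟨q, -, rfl⟩ := Finset.mem_image.1 hx
    have hq : DoubleCoset.mk (K.subgroupOf H) (L.subgroupOf H) q.out =
        DoubleCoset.mk _ _ ⟨h, hh⟩ :=
      (DoubleCoset.eq _ _ _ _).2 ⟨⟨k', hK hk'⟩, hk', ⟨l', hL hl'⟩, hl', Subtype.ext e'⟩
    rw [← hq, DoubleCoset.out_eq']

namespace IsDoubleCosetReps

variable {K H L : Subgroup G} {s : Finset G}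

theorem card_mul_mul_eq (hs : IsDoubleCosetReps K H L s) {h : G} (hh : h ∈ H) :
    Nat.card {p : s × K × L // (p.2.1 : G) * p.1 * p.2.2 = h} =
      Nat.card (K ⊓ MulAut.conj h • L : Subgroup G) := by
  obtain ⟨x, ⟨hx, k, hk, l, hl, e⟩, huniq⟩ := hs.2 h hh
  have hφ (u : (K ⊓ MulAut.conj h • L : Subgroup G)) :
      u * k * x * (l * (h⁻¹ * u * h)⁻¹) = h := by
    rw [show u * k * x * (l * (h⁻¹ * u * h)⁻¹) = u * (k * x * l) * h⁻¹ * (u : G)⁻¹ * h by group,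
      ← e]
    group
  let φ (u : (K ⊓ MulAut.conj h • L : Subgroup G)) :
      {p : s × K × L // (p.2.1 : G) * p.1 * p.2.2 = h} :=
    ⟨(⟨x, hx⟩, ⟨u * k, K.mul_mem u.2.1 hk⟩,
      ⟨l * (h⁻¹ * u * h)⁻¹, L.mul_mem hl (L.inv_mem (mem_conj_iff.1 u.2.2))⟩), hφ u⟩
  refine (Nat.card_congr (Equiv.ofBijective φ ⟨fun u u' huu => ?_, ?_⟩)).symm
  · exact Subtype.ext (mul_right_cancel (congrArg (fun p => (p.1.2.1 : G)) huu))
  · rintro ⟨⟨⟨x', hx'⟩, ⟨k', hk'⟩, ⟨l', hl'⟩⟩, e' : k' * x' * l' = h⟩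
    obtain rfl : x' = x := huniq x' ⟨hx', k', hk', l', hl', e'.symm⟩
    have hu : h⁻¹ * (k' * k⁻¹) * h = l'⁻¹ * l := by
      rw [show l = x'⁻¹ * k⁻¹ * h by rw [e]; group, ← e']
      group
    have h_eq : l * (h⁻¹ * (k' * k⁻¹) * h)⁻¹ = l' := by rw [hu]; group
    refine ⟨⟨k' * k⁻¹, K.mul_mem hk' (K.inv_mem hk), mem_conj_iff.2 ?_⟩, ?_⟩
    · rw [hu]
      exact L.mul_mem (L.inv_mem hl') hl
    · simp only [φ, inv_mul_cancel_right, h_eq]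

theorem sum_card_smul [Finite G] [Fintype H] (hs : IsDoubleCosetReps K H L s)
    (hK : K ≤ H) (hL : L ≤ H) {N : Type*} [AddCommMonoid N] (f : G → N)
    (hf : ∀ k ∈ K, ∀ x, ∀ l ∈ L, f (k * x * l) = f x) :
    ∑ h : H, Nat.card (K ⊓ MulAut.conj (h : G) • L : Subgroup G) • f h =
      (Nat.card K * Nat.card L) • ∑ x ∈ s, f x := by
  classical
  have := Fintype.ofFinite K
  have := Fintype.ofFinite L
  let φ (p : s × K × L) : H := ⟨p.2.1 * p.1 * p.2.2,
    H.mul_mem (H.mul_mem (hK p.2.1.2) (hs.1 _ p.1.2)) (hL p.2.2.2)⟩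
  have hφ (h : H) : Fintype.card {p // φ p = h} =
      Nat.card (K ⊓ MulAut.conj (h : G) • L : Subgroup G) := by
    rw [← hs.card_mul_mul_eq h.2, ← Nat.card_eq_fintype_card]
    exact Nat.card_congr (Equiv.subtypeEquivRight fun p => Subtype.ext_iff)
  calc ∑ h : H, Nat.card (K ⊓ MulAut.conj (h : G) • L : Subgroup G) • f h
      = ∑ h : H, ∑ _p : {p // φ p = h}, f h := by
        simp only [Finset.sum_const, Finset.card_univ, hφ]
    _ = ∑ p : s × K × L, f (φ p) := Fintype.sum_fiberwise' φ fun h => f h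
    _ = ∑ x : s, ∑ _kl : K × L, f x := by
        rw [Fintype.sum_prod_type]
        exact Fintype.sum_congr _ _ fun x => Fintype.sum_congr _ _ fun kl =>
          hf _ kl.1.2 x _ kl.2.2
    _ = (Nat.card K * Nat.card L) • ∑ x ∈ s, f x := by
        simp only [Finset.sum_const, Finset.card_univ, ← Nat.card_eq_fintype_card,
          Nat.card_prod, ← Finset.smul_sum, Finset.sum_coe_sort s f]

end IsDoubleCosetReps

end Subgroups

/-! ### Idempotents of the rational Burnside ring -/

namespace BurnsideRing

variable {G : Type u} [Group G]

@[elab_as_elim]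
theorem induction_on {p : BurnsideRing G → Prop} (a : BurnsideRing G) (mk : ∀ X, p (mk X))
    (add : ∀ a b, p a → p b → p (a + b)) (smul : ∀ (r : ℚ) (a), p a → p (r • a)) : p a := by
  obtain ⟨a, rfl⟩ := Ideal.Quotient.mk_surjective a
  induction a using MonoidAlgebra.induction_on with
  | of c =>
    induction c using Quotient.inductionOn with
    | h X => exact mk X
  | add a b ha hb => exact add _ _ ha hb
  | smul r a ha => exact smul r _ ha

theorem mk_mul_mk (X Y : FinGSet G) : mk X * mk Y = mk (FinGSet.prod X Y) := by
  rw [mk, mk, mk, ← map_mul, MonoidAlgebra.single_mul_single, mul_one]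
  rfl

theorem mk_point : mk (FinGSet.point G) = 1 := rfl

theorem marks_res (K : Subgroup G) (S : Subgroup K) (a : BurnsideRing G) :
    marks K (res K a) (ConjSub.mk S) = marks G a (ConjSub.mk (S.map K.subtype)) := by
  induction a using induction_on with
  | mk X =>
    rw [res_mk, marks_mk, marks_mk, Nat.cast_inj]
    exact Nat.card_congr (Equiv.subtypeEquivRight fun x => by simp; rfl)
  | add a b ha hb => simp only [map_add, Pi.add_apply, ha, hb]
  | smul r a ha => simp only [map_smul, Pi.smul_apply, ha]

variable [Finite G]

open Classical in
theorem marks_idem (H : Subgroup G) : marks G (idem H) = Pi.single (ConjSub.mk H) 1 :=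
  (tomDieck G).apply_symm_apply _

theorem mul_idem (a : BurnsideRing G) (H : Subgroup G) :
    a * idem H = marks G a (ConjSub.mk H) • idem H := by
  classical
  refine marks_bijective.1 ?_
  rw [map_mul, map_smul, marks_idem, ← Pi.single_smul, ← Pi.single_mul_right]
  simp

theorem isIdempotentElem_idem (H : Subgroup G) : IsIdempotentElem (idem H) := by
  classical
  rw [IsIdempotentElem, mul_idem, marks_idem, Pi.single_eq_same, one_smul]

theorem completeOrthogonalIdempotents_idem [Fintype (ConjSub G)] {rep : ConjSub G → Subgroup G}
    (hrep : ∀ c, ConjSub.mk (rep c) = c) :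
    CompleteOrthogonalIdempotents fun c => idem (rep c) := by
  classical
  have h := (CompleteOrthogonalIdempotents.single fun _ : ConjSub G => ℚ).map
    (tomDieck G).symm.toRingEquiv.toRingHom
  convert h using 2 with c
  rw [idem, hrep]
  rfl

theorem res_idem_eq_zero {H K : Subgroup G} (h : ∀ g : G, ¬ MulAut.conj g • H ≤ K) :
    res K (idem H) = 0 := by
  classical
  refine marks_bijective.1 ?_
  rw [map_zero]
  funext c
  induction c using Quotient.inductionOn with
  | h S =>
    refine (marks_res K S _).trans ?_
    rw [marks_idem]
    refine Pi.single_eq_of_ne (fun e => ?_) _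
    obtain ⟨g, hg⟩ := Quotient.exact e.symm
    exact h g (hg ▸ Subgroup.map_subtype_le S)

end BurnsideRing

/-! ### The action of the Burnside ring of `G` on a Mackey functor -/

namespace MackeyFunctor

variable {G : Type u} [Group G] (M : MackeyFunctor.{u, v} G)

/-- The term `I ∘ C_x ∘ R : M(G/L) → M(G/K)` that the double coset `KxL` contributes to the Mackey
formula. -/
def doubleCosetTerm (K L : Subgroup G) (x : G) : M.obj L →ₗ[ℚ] M.obj K :=
  M.ind (inf_le_left : K ⊓ MulAut.conj x • L ≤ K) ∘ₗ M.conj x (conj_inf x K L) ∘ₗ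
    M.res (inf_le_left : L ⊓ MulAut.conj x⁻¹ • K ≤ L)

variable {M}

theorem doubleCosetTerm_apply {K L A B : Subgroup G} {x : G} (hB : K ⊓ MulAut.conj x • L = B)
    (hA : L ⊓ MulAut.conj x⁻¹ • K = A) (hBK : B ≤ K) (hAL : A ≤ L) (e : B = MulAut.conj x • A)
    (m : M.obj L) : M.doubleCosetTerm K L x m = M.ind hBK (M.conj x e (M.res hAL m)) := by
  subst hA hB
  rfl

theorem doubleCosetTerm_mul_left {K L : Subgroup G} {k : G} (hk : k ∈ K) (x : G) :
    M.doubleCosetTerm K L (k * x) = M.doubleCosetTerm K L x := by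
  have hK : K = MulAut.conj k • K := (Subgroup.conj_smul_eq_self_of_mem hk).symm
  have hB : K ⊓ MulAut.conj (k * x) • L = MulAut.conj k • (K ⊓ MulAut.conj x • L) := by
    rw [map_mul, mul_smul, Subgroup.smul_inf, ← hK]
  have hA : L ⊓ MulAut.conj (k * x)⁻¹ • K = L ⊓ MulAut.conj x⁻¹ • K := by
    rw [mul_inv_rev, map_mul, mul_smul, Subgroup.conj_smul_eq_self_of_mem (K.inv_mem hk)]
  ext m
  rw [doubleCosetTerm_apply rfl hA inf_le_left inf_le_left (hA ▸ conj_inf (k * x) K L),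
    M.conj_mul k x (conj_inf x K L) hB, M.ind_conj k inf_le_left inf_le_left hB hK,
    M.conj_self k hk]
  rfl

theorem doubleCosetTerm_mul_right {K L : Subgroup G} (x : G) {l : G} (hl : l ∈ L) :
    M.doubleCosetTerm K L (x * l) = M.doubleCosetTerm K L x := by
  have hL : L = MulAut.conj l • L := (Subgroup.conj_smul_eq_self_of_mem hl).symm
  have hB : K ⊓ MulAut.conj (x * l) • L = K ⊓ MulAut.conj x • L := by
    rw [map_mul, mul_smul, ← hL]
  have hA : L ⊓ MulAut.conj x⁻¹ • K = MulAut.conj l • (L ⊓ MulAut.conj (x * l)⁻¹ • K) := by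
    rw [Subgroup.smul_inf, ← hL, mul_inv_rev, map_mul, mul_smul, map_inv _ l, smul_inv_smul]
  ext m
  rw [doubleCosetTerm_apply hB rfl inf_le_left inf_le_left (hB ▸ conj_inf (x * l) K L),
    M.conj_mul x l hA (conj_inf x K L), ← M.res_conj l inf_le_left inf_le_left hA hL,
    M.conj_self l hl]
  rfl

theorem card_smul_res_ind [Finite G] {K L H : Subgroup G} [Fintype H] (hK : K ≤ H) (hL : L ≤ H)
    (m : M.obj L) :
    ((Nat.card K : ℚ) * Nat.card L) • M.res hK (M.ind hL m) = ∑ h : H,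
      (Nat.card (K ⊓ MulAut.conj (h : G) • L : Subgroup G) : ℚ) •
        M.doubleCosetTerm K L h m := by
  obtain ⟨s, hs⟩ := exists_isDoubleCosetReps hK hL
  have hsum := hs.sum_card_smul hK hL (fun x => M.doubleCosetTerm K L x m) fun k hk x l hl =>
    by rw [doubleCosetTerm_mul_right _ hl, doubleCosetTerm_mul_left hk]
  have hmackey : M.res hK (M.ind hL m) = ∑ x ∈ s, M.doubleCosetTerm K L x m :=
    M.mackey hK hL s hs m
  simp only [Nat.cast_smul_eq_nsmul, ← Nat.cast_mul, hsum, hmackey]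

variable (M) in
/-- The operator `I ∘ R` on `M(G/K)` through `K ∩ S`, weighted by `|K ∩ S| / |K|`: the contribution
of a point with stabilizer `S` to the action of a finite `G`-set on `M(G/K)`. -/
noncomputable def pointAct (K S : Subgroup G) : Module.End ℚ (M.obj K) :=
  ((Nat.card (K ⊓ S : Subgroup G) : ℚ) / Nat.card K) •
    (M.ind (inf_le_left : K ⊓ S ≤ K) ∘ₗ M.res (inf_le_left : K ⊓ S ≤ K))

theorem pointAct_apply {K S T : Subgroup G} (e : K ⊓ S = T) (hT : T ≤ K) (m : M.obj K) :
    M.pointAct K S m = ((Nat.card T : ℚ) / Nat.card K) • M.ind hT (M.res hT m) := by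
  subst e
  rfl

theorem conj_pointAct {K K' : Subgroup G} (S : Subgroup G) (g : G) (e : K' = MulAut.conj g • K)
    (m : M.obj K) :
    M.conj g e (M.pointAct K S m) = M.pointAct K' (MulAut.conj g • S) (M.conj g e m) := by
  have hS : K' ⊓ MulAut.conj g • S = MulAut.conj g • (K ⊓ S) := by rw [Subgroup.smul_inf, e]
  have hcS : Nat.card (K' ⊓ MulAut.conj g • S : Subgroup G) = Nat.card (K ⊓ S : Subgroup G) := by
    rw [hS, card_conj_smul]
  have hcK : Nat.card K' = Nat.card K := by rw [e, card_conj_smul]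
  rw [pointAct_apply rfl inf_le_left, pointAct_apply rfl inf_le_left, map_smul, hcS, hcK,
    ← M.ind_conj g inf_le_left inf_le_left hS e, M.res_conj g inf_le_left inf_le_left hS e]

variable (M) in
/-- The action of `A_ℚ(G)` on `M(G/K)` through the restriction map `A_ℚ(G) → A_ℚ(K)`. -/
noncomputable def globalAct (K : Subgroup G) : BurnsideRing G →ₗ[ℚ] Module.End ℚ (M.obj K) :=
  M.burnsideAct K ∘ₗ (BurnsideRing.res K).toLinearMap

theorem globalAct_mk (K : Subgroup G) (X : FinGSet G) [Fintype X.carrier] (m : M.obj K) :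
    M.globalAct K (BurnsideRing.mk X) m =
      ∑ x : X.carrier, M.pointAct K (MulAction.stabilizer G x) m := by
  have hres : M.globalAct K (BurnsideRing.mk X) = M.setAct K (FinGSet.restrict K X) :=
    (congrArg _ (BurnsideRing.res_mk K X)).trans (M.burnsideAct_mk K _)
  rw [hres, setAct, LinearMap.sum_apply]
  refine @Fintype.sum_equiv (FinGSet.restrict K X).carrier X.carrier _ (Fintype.ofFinite _) _ _
    (Equiv.refl _) _ _ fun x => ?_
  have hstab : K ⊓ MulAction.stabilizer G (show X.carrier from x) =
      (MulAction.stabilizer K x).map K.subtype :=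
    (inf_comm _ _).trans (Subgroup.subgroupOf_map_subtype ..).symm
  change _ = M.pointAct K (MulAction.stabilizer G (show X.carrier from x)) m
  rw [pointAct_apply hstab (Subgroup.map_subtype_le _), Subgroup.card_subtype]
  rfl

theorem sum_pointAct_conj (K : Subgroup G) (X : FinGSet G) [Fintype X.carrier] (g : G)
    (m : M.obj K) :
    ∑ x : X.carrier, M.pointAct K (MulAut.conj g • MulAction.stabilizer G x) m =
      M.globalAct K (BurnsideRing.mk X) m := by
  rw [globalAct_mk]
  refine Fintype.sum_equiv (MulAction.toPerm g) _ _ fun x => ?_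
  rw [MulAction.toPerm_apply, MulAction.stabilizer_smul_eq_stabilizer_map_conj]
  rfl

theorem conj_globalAct {K K' : Subgroup G} (g : G) (e : K' = MulAut.conj g • K)
    (a : BurnsideRing G) (m : M.obj K) :
    M.conj g e (M.globalAct K a m) = M.globalAct K' a (M.conj g e m) := by
  induction a using BurnsideRing.induction_on with
  | mk X =>
    have := Fintype.ofFinite X.carrier
    rw [globalAct_mk, map_sum, ← sum_pointAct_conj K' X g]
    simp only [conj_pointAct]
  | add a b ha hb => simp only [map_add, LinearMap.add_apply, ha, hb]
  | smul r a ha => simp only [map_smul, LinearMap.smul_apply, ha]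

theorem Hom.app_globalAct {N : MackeyFunctor.{u, v} G} (f : Hom M N) (K : Subgroup G)
    (a : BurnsideRing G) (m : M.obj K) :
    f.app K (M.globalAct K a m) = N.globalAct K a (f.app K m) := by
  induction a using BurnsideRing.induction_on with
  | mk X =>
    have := Fintype.ofFinite X.carrier
    rw [globalAct_mk, globalAct_mk, map_sum]
    refine Finset.sum_congr rfl fun x _ => ?_
    rw [pointAct_apply rfl inf_le_left, pointAct_apply rfl inf_le_left, map_smul, f.app_ind,
      f.app_res]
  | add a b ha hb => simp only [map_add, LinearMap.add_apply, ha, hb]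
  | smul r a ha => simp only [map_smul, LinearMap.smul_apply, ha]

variable [Finite G]

theorem pointAct_inf (K S T : Subgroup G) (m : M.obj K) :
    M.pointAct K (S ⊓ T) m = ((Nat.card (K ⊓ S : Subgroup G) : ℚ) / Nat.card K) •
      M.ind inf_le_left (M.pointAct (K ⊓ S) T (M.res inf_le_left m)) := by
  rw [pointAct_apply (T := K ⊓ S ⊓ T) (inf_assoc _ _ _).symm (inf_le_left.trans inf_le_left),
    pointAct_apply rfl inf_le_left, map_smul, smul_smul, ← M.res_trans, ← M.ind_trans,
    mul_comm, div_mul_div_cancel₀ (cast_card_ne_zero _)]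

theorem pointAct_of_le {K S : Subgroup G} (h : K ≤ S) (m : M.obj K) : M.pointAct K S m = m := by
  rw [pointAct_apply (inf_eq_left.2 h) le_rfl, div_self (cast_card_ne_zero K), one_smul,
    M.ind_self, M.res_self]

theorem card_smul_pointAct {K S T : Subgroup G} (e : K ⊓ S = T) (hT : T ≤ K) (m : M.obj K) :
    (Nat.card K : ℚ) • M.pointAct K S m = (Nat.card T : ℚ) • M.ind hT (M.res hT m) := by
  rw [pointAct_apply e hT, smul_smul, mul_div_cancel₀ _ (cast_card_ne_zero K)]

theorem card_smul_doubleCosetTerm_res {K H S : Subgroup G} (hK : K ≤ H) {h : G} (hh : h ∈ H)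
    (m : M.obj H) :
    (Nat.card (K ⊓ MulAut.conj h • (H ⊓ S) : Subgroup G) : ℚ) •
        M.doubleCosetTerm K (H ⊓ S) h (M.res inf_le_left m) =
      (Nat.card K : ℚ) • M.pointAct K (MulAut.conj h • S) (M.res hK m) := by
  have hH : H = MulAut.conj h • H := (Subgroup.conj_smul_eq_self_of_mem hh).symm
  have hS : K ⊓ MulAut.conj h • S = K ⊓ MulAut.conj h • (H ⊓ S) := by
    rw [Subgroup.smul_inf, ← hH, ← inf_assoc, inf_eq_left.2 hK]
  rw [card_smul_pointAct hS inf_le_left,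
    doubleCosetTerm_apply rfl rfl inf_le_left inf_le_left (conj_inf h K _), ← M.res_trans,
    ← M.res_conj h _ (inf_le_left.trans hK) _ hH, M.conj_self h hh, M.res_trans]

theorem card_smul_ind_doubleCosetTerm {K L S : Subgroup G} (hL : L ≤ K) {k : G} (hk : k ∈ K)
    (m : M.obj L) :
    (Nat.card (K ⊓ S ⊓ MulAut.conj k • L : Subgroup G) : ℚ) •
        M.ind (inf_le_left : K ⊓ S ≤ K) (M.doubleCosetTerm (K ⊓ S) L k m) =
      (Nat.card L : ℚ) • M.ind hL (M.pointAct L (MulAut.conj k⁻¹ • S) m) := by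
  have hK : K = MulAut.conj k • K := (Subgroup.conj_smul_eq_self_of_mem hk).symm
  have hS : L ⊓ MulAut.conj k⁻¹ • S = L ⊓ MulAut.conj k⁻¹ • (K ⊓ S) := by
    rw [Subgroup.smul_inf, Subgroup.conj_smul_eq_self_of_mem (K.inv_mem hk), ← inf_assoc,
      inf_eq_left.2 hL]
  rw [← map_smul _ (Nat.card L : ℚ), card_smul_pointAct hS inf_le_left, map_smul, conj_inf,
    card_conj_smul, doubleCosetTerm_apply rfl rfl inf_le_left inf_le_left (conj_inf k _ L),
    ← M.ind_trans, ← M.ind_trans, M.ind_conj k (inf_le_left.trans hL) _ _ hK, M.conj_self k hk]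

theorem card_smul_res_pointAct {K H : Subgroup G} [Fintype H] (hK : K ≤ H) (S : Subgroup G)
    (m : M.obj H) :
    (Nat.card H : ℚ) • M.res hK (M.pointAct H S m) =
      ∑ h : H, M.pointAct K (MulAut.conj (h : G) • S) (M.res hK m) := by
  refine (smul_right_inj (cast_card_ne_zero K)).1 ?_
  rw [← map_smul, card_smul_pointAct rfl inf_le_left, map_smul, smul_smul,
    card_smul_res_ind hK inf_le_left, Finset.smul_sum]
  exact Finset.sum_congr rfl fun h _ => card_smul_doubleCosetTerm_res hK h.2 m

theorem card_smul_pointAct_ind {L K : Subgroup G} [Fintype K] (hL : L ≤ K) (S : Subgroup G)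
    (m : M.obj L) :
    (Nat.card K : ℚ) • M.pointAct K S (M.ind hL m) =
      ∑ k : K, M.ind hL (M.pointAct L (MulAut.conj (k : G)⁻¹ • S) m) := by
  refine (smul_right_inj (cast_card_ne_zero L)).1 ?_
  rw [card_smul_pointAct rfl inf_le_left, smul_smul, mul_comm, ← map_smul,
    card_smul_res_ind inf_le_left hL, map_sum, Finset.smul_sum]
  refine Finset.sum_congr rfl fun k _ => ?_
  rw [map_smul, card_smul_ind_doubleCosetTerm hL k.2]

theorem res_globalAct {K H : Subgroup G} (h : K ≤ H) (a : BurnsideRing G) (m : M.obj H) :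
    M.res h (M.globalAct H a m) = M.globalAct K a (M.res h m) := by
  induction a using BurnsideRing.induction_on with
  | mk X =>
    have := Fintype.ofFinite X.carrier
    have := Fintype.ofFinite H
    refine (smul_right_inj (cast_card_ne_zero H)).1 ?_
    simp only [globalAct_mk H, map_sum, Finset.smul_sum, card_smul_res_pointAct]
    rw [Finset.sum_comm]
    simp only [sum_pointAct_conj, Finset.sum_const, Finset.card_univ, Nat.cast_smul_eq_nsmul,
      Nat.card_eq_fintype_card]
  | add a b ha hb => simp only [map_add, LinearMap.add_apply, ha, hb]
  | smul r a ha => simp only [map_smul, LinearMap.smul_apply, ha]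

theorem ind_globalAct {K H : Subgroup G} (h : K ≤ H) (a : BurnsideRing G) (m : M.obj K) :
    M.ind h (M.globalAct K a m) = M.globalAct H a (M.ind h m) := by
  induction a using BurnsideRing.induction_on with
  | mk X =>
    have := Fintype.ofFinite X.carrier
    have := Fintype.ofFinite H
    refine (smul_right_inj (cast_card_ne_zero H)).1 ?_
    simp only [globalAct_mk H, Finset.smul_sum, card_smul_pointAct_ind]
    rw [Finset.sum_comm]
    simp only [← map_sum, sum_pointAct_conj, Finset.sum_const, Finset.card_univ,
      Nat.cast_smul_eq_nsmul, Nat.card_eq_fintype_card, map_nsmul]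
  | add a b ha hb => simp only [map_add, LinearMap.add_apply, ha, hb]
  | smul r a ha => simp only [map_smul, LinearMap.smul_apply, ha]

theorem globalAct_mk_mul_mk (K : Subgroup G) (X Y : FinGSet G) (m : M.obj K) :
    M.globalAct K (BurnsideRing.mk X * BurnsideRing.mk Y) m =
      M.globalAct K (BurnsideRing.mk X) (M.globalAct K (BurnsideRing.mk Y) m) := by
  have := Fintype.ofFinite X.carrier
  have := Fintype.ofFinite Y.carrier
  let _ : Fintype (FinGSet.prod X Y).carrier := inferInstanceAs (Fintype (X.carrier × Y.carrier))
  have hstab (x : X.carrier) (y : Y.carrier) :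
      MulAction.stabilizer G (show (FinGSet.prod X Y).carrier from (x, y)) =
        MulAction.stabilizer G x ⊓ MulAction.stabilizer G y :=
    Subgroup.ext fun _ => Prod.ext_iff
  rw [BurnsideRing.mk_mul_mk, globalAct_mk, globalAct_mk K X]
  refine (Fintype.sum_prod_type _).trans (Finset.sum_congr rfl fun x _ => ?_)
  rw [pointAct_apply rfl inf_le_left, res_globalAct, globalAct_mk, map_sum, Finset.smul_sum]
  refine Finset.sum_congr rfl fun y _ => ?_
  rw [← pointAct_inf, hstab]

theorem globalAct_mul (K : Subgroup G) (a b : BurnsideRing G) (m : M.obj K) :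
    M.globalAct K (a * b) m = M.globalAct K a (M.globalAct K b m) := by
  induction a using BurnsideRing.induction_on with
  | mk X =>
    induction b using BurnsideRing.induction_on with
    | mk Y => exact globalAct_mk_mul_mk K X Y m
    | add b c hb hc => simp only [mul_add, map_add, LinearMap.add_apply, hb, hc]
    | smul r b hb => simp only [mul_smul_comm, map_smul, LinearMap.smul_apply, hb]
  | add a c ha hc => simp only [add_mul, map_add, LinearMap.add_apply, ha, hc]
  | smul r a ha => simp only [smul_mul_assoc, map_smul, LinearMap.smul_apply, ha]

theorem globalAct_one (K : Subgroup G) (m : M.obj K) : M.globalAct K 1 m = m := by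
  let _ : Fintype (FinGSet.point G).carrier := inferInstanceAs (Fintype PUnit)
  rw [← BurnsideRing.mk_point, globalAct_mk]
  exact (Fintype.sum_unique (ι := PUnit) _).trans (pointAct_of_le (fun g _ => rfl) m)

theorem isIdemPart_iff {H : Subgroup G} :
    IsIdemPart H M ↔
      ∀ (K : Subgroup G) (m : M.obj K), M.globalAct K (BurnsideRing.idem H) m = m := by
  refine forall_congr' fun K => LinearMap.range_eq_top.trans ⟨fun h m => ?_, fun h m => ⟨m, h m⟩⟩
  obtain ⟨m, rfl⟩ := h m
  exact (globalAct_mul K _ _ m).symm.trans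
    (by rw [(BurnsideRing.isIdempotentElem_idem H).eq]; rfl)

end MackeyFunctor

/-! ### Mackey functors on which the idempotent of a subgroup acts as the identity -/

namespace MackeyFunctor

variable {G : Type u} [Group G]

theorem conj_conj_inv {M : MackeyFunctor.{u, v} G} {K K' : Subgroup G} (g : G)
    (e : K' = MulAut.conj g • K) (e' : K = MulAut.conj g⁻¹ • K') (m : M.obj K') :
    M.conj g e (M.conj g⁻¹ e' m) = m := by
  rw [← M.conj_mul g g⁻¹ e' e (by rw [mul_inv_cancel, map_one, one_smul]),
    M.conj_self _ (by rw [mul_inv_cancel]; exact K'.one_mem)]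

theorem doubleCosetTerm_of_le {M : MackeyFunctor.{u, v} G} {K L A : Subgroup G} {x : G}
    (e : K = MulAut.conj x • A) (hAL : A ≤ L) (m : M.obj L) :
    M.doubleCosetTerm K L x m = M.conj x e (M.res hAL m) := by
  have hA : L ⊓ MulAut.conj x⁻¹ • K = A := by
    rw [e, map_inv, inv_smul_smul, inf_eq_right.2 hAL]
  have hB : K ⊓ MulAut.conj x • L = K := by rw [conj_inf, hA, ← e]
  rw [doubleCosetTerm_apply hB hA le_rfl hAL e, M.ind_self]

@[ext]
theorem hom_ext {M N : MackeyFunctor.{u, v} G} {f g : M ⟶ N}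
    (h : ∀ (K : Subgroup G) (m : M.obj K), Hom.app f K m = Hom.app g K m) : f = g :=
  Hom.ext (funext fun K => LinearMap.ext (h K))

theorem isIso_of_bijective {M N : MackeyFunctor.{u, v} G} (f : Hom M N)
    (h : ∀ K, Function.Bijective (f.app K)) : IsIso (show M ⟶ N from f) := by
  let e (K : Subgroup G) : M.obj K ≃ₗ[ℚ] N.obj K := LinearEquiv.ofBijective (f.app K) (h K)
  let g : Hom N M :=
    { app := fun K => (e K).symm.toLinearMap
      app_res := fun {K A} h m => (e K).symm_apply_eq.2
        ((f.app_res h _).trans (congrArg _ ((e A).apply_symm_apply m))).symm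
      app_ind := fun {K A} h m => (e A).symm_apply_eq.2
        ((f.app_ind h _).trans (congrArg _ ((e K).apply_symm_apply m))).symm
      app_conj := fun x {K A} h m => (e A).symm_apply_eq.2
        ((f.app_conj x h _).trans (congrArg _ ((e K).apply_symm_apply m))).symm }
  exact ⟨g, hom_ext fun K m => (e K).symm_apply_apply m,
    hom_ext fun K m => (e K).apply_symm_apply m⟩

variable [Finite G] {M N : MackeyFunctor.{u, v} G} {H K : Subgroup G}

namespace IsIdemPart

theorem globalAct_eq_smul (hM : IsIdemPart H M) (K : Subgroup G) (a : BurnsideRing G)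
    (m : M.obj K) : M.globalAct K a m = BurnsideRing.marks G a (ConjSub.mk H) • m := by
  conv_lhs => rw [← isIdemPart_iff.1 hM K m]
  rw [← globalAct_mul, BurnsideRing.mul_idem, map_smul, LinearMap.smul_apply,
    isIdemPart_iff.1 hM]

theorem eq_zero_of_forall_not_le (hM : IsIdemPart H M) (h : ∀ g : G, ¬ MulAut.conj g • H ≤ K)
    (m : M.obj K) : m = 0 := by
  rw [← isIdemPart_iff.1 hM K m]
  change M.burnsideAct K (BurnsideRing.res K (BurnsideRing.idem H)) m = 0
  rw [BurnsideRing.res_idem_eq_zero h, map_zero, LinearMap.zero_apply]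

theorem eq_zero_of_lt_conj (hM : IsIdemPart H M) {g : G} (h : K < MulAut.conj g • H)
    (m : M.obj K) : m = 0 :=
  hM.eq_zero_of_forall_not_le
    (fun _ hg' => h.not_ge ((conj_smul_eq_of_le (hg'.trans h.le)).ge.trans hg')) m

theorem pointAct_conj_eq_zero (hM : IsIdemPart H M) {g : G} (h : ¬ MulAut.conj g • H ≤ K)
    (m : M.obj K) : M.pointAct K (MulAut.conj g • H) m = 0 := by
  rw [pointAct_apply rfl inf_le_left,
    hM.eq_zero_of_lt_conj (inf_lt_right.2 h) (M.res inf_le_left m), map_zero, smul_zero]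

theorem mem_of_ind_res_mem (hM : IsIdemPart H M) {m : M.obj K} {P : Submodule ℚ (M.obj K)}
    (h : ∀ (g : G) (hg : MulAut.conj g • H ≤ K), M.ind hg (M.res hg m) ∈ P) : m ∈ P := by
  -- `[G/H]` acts on `e_H M` by the nonzero scalar `|(G/H)^H|`.
  let _ : Fintype (FinGSet.orbit H).carrier := Fintype.ofFinite (G ⧸ H)
  rw [← P.smul_mem_iff (Nat.cast_ne_zero.2 (FinGSet.fixedCard_self_ne_zero H) :
    (FinGSet.fixedCard H (FinGSet.orbit H) : ℚ) ≠ 0), ← BurnsideRing.marks_mk,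
    ← hM.globalAct_eq_smul, globalAct_mk]
  refine P.sum_mem fun x _ => ?_
  induction x using QuotientGroup.induction_on with
  | H g =>
    change M.pointAct K (MulAction.stabilizer G (g : G ⧸ H)) m ∈ P
    rw [stabilizer_quotientGroup_mk]
    by_cases hg : MulAut.conj g • H ≤ K
    · rw [pointAct_apply (inf_eq_right.2 hg) hg]
      exact P.smul_mem _ (h g hg)
    · rw [hM.pointAct_conj_eq_zero hg]
      exact P.zero_mem

theorem eq_zero_of_res_eq_zero (hM : IsIdemPart H M) {m : M.obj K}
    (h : ∀ (g : G) (hg : MulAut.conj g • H ≤ K), M.res hg m = 0) : m = 0 := by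
  rw [← Submodule.mem_bot ℚ]
  refine hM.mem_of_ind_res_mem fun g hg => ?_
  rw [h g hg, map_zero]
  exact Submodule.zero_mem _

theorem doubleCosetTerm_eq_zero (hM : IsIdemPart H M) {L : Subgroup G} {g x : G}
    (h : ¬ MulAut.conj g • H ≤ MulAut.conj x • L) (m : M.obj L) :
    M.doubleCosetTerm (MulAut.conj g • H) L x m = 0 := by
  rw [doubleCosetTerm_apply rfl rfl inf_le_left inf_le_left (conj_inf x _ L),
    hM.eq_zero_of_lt_conj (inf_lt_left.2 h) (M.conj x _ _), map_zero]

/-- The morphism between objects of `e_H Mack(G)` with given components: compatibility with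
induction follows from compatibility with restriction and conjugation. -/
def homMk (hM : IsIdemPart H M) (hN : IsIdemPart H N) (app : ∀ K, M.obj K →ₗ[ℚ] N.obj K)
    (app_res : ∀ {K L : Subgroup G} (h : K ≤ L) (m : M.obj L),
      app K (M.res h m) = N.res h (app L m))
    (app_conj : ∀ (g : G) {K K' : Subgroup G} (e : K' = MulAut.conj g • K) (m : M.obj K),
      app K' (M.conj g e m) = N.conj g e (app K m)) : Hom M N where
  app := app
  app_res := app_res
  app_conj := app_conj
  app_ind {L K} hL m := by
    rw [← sub_eq_zero]
    refine hN.eq_zero_of_res_eq_zero fun g hg => ?_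
    obtain ⟨s, hs⟩ := exists_isDoubleCosetReps hg hL
    have hM_mackey : M.res hg (M.ind hL m) = ∑ x ∈ s, M.doubleCosetTerm _ L x m :=
      M.mackey hg hL s hs m
    have hN_mackey : N.res hg (N.ind hL (app L m)) =
        ∑ x ∈ s, N.doubleCosetTerm _ L x (app L m) := N.mackey hg hL s hs _
    rw [map_sub, ← app_res, hM_mackey, hN_mackey, map_sum, sub_eq_zero]
    refine Finset.sum_congr rfl fun x _ => ?_
    by_cases h : MulAut.conj g • H ≤ MulAut.conj x • L
    · have e : MulAut.conj g • H = MulAut.conj x • MulAut.conj x⁻¹ • MulAut.conj g • H := by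
        rw [map_inv, smul_inv_smul]
      have hL' : MulAut.conj x⁻¹ • MulAut.conj g • H ≤ L := by
        rwa [map_inv, Subgroup.pointwise_smul_subset_iff, inv_inv]
      rw [doubleCosetTerm_of_le e hL', doubleCosetTerm_of_le e hL', app_conj, app_res]
    · rw [hM.doubleCosetTerm_eq_zero h, hN.doubleCosetTerm_eq_zero h, map_zero]

theorem bijective_app (hM : IsIdemPart H M) (hN : IsIdemPart H N) {f : Hom M N}
    (hf : Function.Bijective (f.app H)) (K : Subgroup G) : Function.Bijective (f.app K) := by
  have hinv (g : G) : H = MulAut.conj g⁻¹ • MulAut.conj g • H := by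
    rw [map_inv, inv_smul_smul]
  constructor
  · rw [injective_iff_map_eq_zero]
    refine fun m hm => hM.eq_zero_of_res_eq_zero fun g hg => ?_
    have h0 : M.conj g⁻¹ (hinv g) (M.res hg m) = 0 := hf.1 <| by
      rw [f.app_conj, f.app_res, hm, map_zero, map_zero, map_zero]
    rw [← conj_conj_inv g rfl (hinv g) (M.res hg m), h0, map_zero]
  · refine fun y => hN.mem_of_ind_res_mem (P := LinearMap.range (f.app K)) fun g hg => ?_
    obtain ⟨m, hm⟩ := hf.2 (N.conj g⁻¹ (hinv g) (N.res hg y))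
    refine ⟨M.ind hg (M.conj g rfl m), ?_⟩
    rw [f.app_ind, f.app_conj, hm, conj_conj_inv]

end IsIdemPart

theorem globalAct_self_of_forall_lt_eq_zero (h : ∀ T < H, ∀ m : M.obj T, m = 0)
    (a : BurnsideRing G) (m : M.obj H) :
    M.globalAct H a m = BurnsideRing.marks G a (ConjSub.mk H) • m := by
  classical
  induction a using BurnsideRing.induction_on with
  | mk X =>
    have := Fintype.ofFinite X.carrier
    have hpoint (S : Subgroup G) : M.pointAct H S m = if H ≤ S then m else 0 := by
      split_ifs with hS
      · exact pointAct_of_le hS m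
      · rw [pointAct_apply rfl inf_le_left, h _ (inf_lt_left.2 hS) (M.res _ m), map_zero,
          smul_zero]
    simp only [globalAct_mk, BurnsideRing.marks_mk, hpoint, ← Finset.sum_filter,
      Finset.sum_const, FinGSet.fixedCard, Nat.cast_smul_eq_nsmul, Nat.card_eq_fintype_card,
      Fintype.card_subtype, SetLike.le_def, MulAction.mem_stabilizer_iff]
  | add a b ha hb => simp only [map_add, LinearMap.add_apply, ha, hb, Pi.add_apply, add_smul]
  | smul r a ha =>
    simp only [map_smul, LinearMap.smul_apply, ha, Pi.smul_apply, smul_eq_mul, mul_smul]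

theorem isIdemPart_of_eq_zero_of_res_eq_zero
    (h : ∀ (K : Subgroup G) (m : M.obj K),
      (∀ (g : G) (hg : MulAut.conj g • H ≤ K), M.res hg m = 0) → m = 0) :
    IsIdemPart H M := by
  classical
  have hlt (T : Subgroup G) (hT : T < H) (m : M.obj T) : m = 0 := by
    refine h T m fun g hg => (hT.not_ge ?_).elim
    have : MulAut.conj g • H = H := Subgroup.eq_of_le_of_card_ge (hg.trans hT.le)
      (by rw [card_conj_smul])
    rwa [← this]
  have hself (m : M.obj H) : M.globalAct H (BurnsideRing.idem H) m = m := by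
    rw [globalAct_self_of_forall_lt_eq_zero hlt, BurnsideRing.marks_idem, Pi.single_eq_same,
      one_smul]
  refine isIdemPart_iff.2 fun K m => sub_eq_zero.1 (h K _ fun g hg => ?_)
  have e : H = MulAut.conj g⁻¹ • MulAut.conj g • H := by rw [map_inv, inv_smul_smul]
  rw [map_sub, res_globalAct, sub_eq_zero, ← conj_conj_inv g rfl e (M.res hg m),
    ← conj_globalAct, hself]

end MackeyFunctor

/-! ### The equivalence between `e_H Mack(G)` and modules over the Weyl group -/

namespace MackeyFunctor

variable {G : Type u} [Group G] {H : Subgroup G}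

namespace FixPts

variable (H) in
/-- The base point `H` of `(G/H)^H`. -/
def base : FixPts H H := mk 1 ((FinGSet.fixed_mk_iff H H 1).2 (by rw [map_one, one_smul]))

theorem lmul_mul {K : Subgroup G} (n n' : Subgroup.normalizer (H : Set G)) (σ : FixPts H K) :
    lmul (n * n') σ = lmul n (lmul n' σ) :=
  Subtype.ext (mul_smul (n : G) (n' : G) σ.1)

theorem lmul_base_eq_iff (n n' : Subgroup.normalizer (H : Set G)) :
    lmul n (base H) = lmul n' (base H) ↔ (n : WeylGroup H) = n' :=
  (eq_iff (n * 1 : G) (n' * 1) rfl rfl).trans <| by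
    rw [mul_one, mul_one, QuotientGroup.eq, Subgroup.mem_subgroupOf]
    rfl

theorem exists_lmul_base [Finite G] (σ : FixPts H H) :
    ∃ n : Subgroup.normalizer (H : Set G), lmul n (base H) = σ := by
  obtain ⟨g, hg, rfl⟩ := exists_mk σ
  have hconj : H = MulAut.conj g • H :=
    Subgroup.eq_of_le_of_card_ge ((FinGSet.fixed_mk_iff H H g).1 hg) (by rw [card_conj_smul])
  have hn : g ∈ Subgroup.normalizer (H : Set G) := by
    refine Subgroup.mem_normalizer_iff.2 fun x => ?_
    conv_rhs => rw [hconj, mem_conj_iff]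
    simp [mul_assoc]
  exact ⟨⟨g, hn⟩, (eq_iff (g * 1) g rfl rfl).2 (by simp)⟩

theorem rmul_base (n : Subgroup.normalizer (H : Set G)) (e : H = MulAut.conj (n : G) • H) :
    rmul (n : G) e (base H) = lmul n (base H) :=
  (eq_iff (1 * n : G) (n * 1) rfl rfl).2 (by simp)

theorem le_conj_out {K : Subgroup G} (σ : FixPts H K) : H ≤ MulAut.conj σ.1.out • K := by
  rw [← FinGSet.fixed_mk_iff, QuotientGroup.out_eq']
  exact σ.2

end FixPts

section ResAlong

variable {M : MackeyFunctor.{u, v} G} {K L : Subgroup G}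

variable (M) in
/-- The map `M(G/K) → M(G/H)` induced by the `G`-map `G/H → G/K` that sends `H` to `σ`. -/
noncomputable def resAlong (σ : FixPts H K) : M.obj K →ₗ[ℚ] M.obj H :=
  M.res σ.le_conj_out ∘ₗ M.conj σ.1.out rfl

theorem resAlong_mk {g : G} (hg : ∀ h ∈ H, h • (g : G ⧸ K) = g) {K' : Subgroup G}
    (e : K' = MulAut.conj g • K) (h : H ≤ K') (m : M.obj K) :
    M.resAlong (FixPts.mk g hg) m = M.res h (M.conj g e m) := by
  obtain ⟨k, hk⟩ := QuotientGroup.mk_out_eq_mul K g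
  have eK : K = MulAut.conj (k : G) • K := (Subgroup.conj_smul_eq_self_of_mem k.2).symm
  have hout : K' = MulAut.conj (g : G ⧸ K).out • K := by rw [hk, map_mul, mul_smul, ← eK, e]
  have hconj (x : G) (hx : x = g * k) (ex : K' = MulAut.conj x • K) :
      M.conj x ex m = M.conj g e m := by
    subst hx
    rw [M.conj_mul g k eK e, M.conj_self k k.2]
  rw [← hconj _ hk hout]
  subst hout
  rfl

theorem conj_resAlong (n : Subgroup.normalizer (H : Set G)) (e : H = MulAut.conj (n : G) • H)
    (σ : FixPts H K) (m : M.obj K) :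
    M.conj (n : G) e (M.resAlong σ m) = M.resAlong (FixPts.lmul n σ) m := by
  obtain ⟨g, hg, rfl⟩ := FixPts.exists_mk σ
  have hgK := (FinGSet.fixed_mk_iff H K g).1 hg
  have e' : MulAut.conj (n * g : G) • K = MulAut.conj (n : G) • MulAut.conj g • K := by
    rw [map_mul, mul_smul]
  have hn : H ≤ MulAut.conj (n * g : G) • K :=
    (FinGSet.fixed_mk_iff H K _).1 (FixPts.lmul n (FixPts.mk g hg)).2
  rw [resAlong_mk hg rfl hgK, ← M.res_conj n hgK hn e e', ← M.conj_mul n g rfl e' rfl]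
  exact (resAlong_mk (FixPts.lmul n (FixPts.mk g hg)).2 rfl hn m).symm

theorem resAlong_res (h : K ≤ L) (σ : FixPts H K) (m : M.obj L) :
    M.resAlong σ (M.res h m) = M.resAlong (FixPts.proj h σ) m := by
  obtain ⟨g, hg, rfl⟩ := FixPts.exists_mk σ
  have hgK := (FinGSet.fixed_mk_iff H K g).1 hg
  have hKL : MulAut.conj g • K ≤ MulAut.conj g • L :=
    Subgroup.pointwise_smul_le_pointwise_smul_iff.2 h
  rw [resAlong_mk hg rfl hgK, ← M.res_conj g h hKL rfl rfl, ← M.res_trans]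
  exact (resAlong_mk (FixPts.proj h (FixPts.mk g hg)).2 rfl (hgK.trans hKL) m).symm

theorem resAlong_conj (g : G) (e : L = MulAut.conj g • K) (σ : FixPts H L) (m : M.obj K) :
    M.resAlong σ (M.conj g e m) = M.resAlong (FixPts.rmul g e σ) m := by
  obtain ⟨x, hx, rfl⟩ := FixPts.exists_mk σ
  have hxL := (FinGSet.fixed_mk_iff H L x).1 hx
  have e' : MulAut.conj x • L = MulAut.conj (x * g) • K := by rw [e, map_mul, mul_smul]
  rw [resAlong_mk hx rfl hxL, ← M.conj_mul x g e rfl e']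
  exact (resAlong_mk (FixPts.rmul g e (FixPts.mk x hx)).2 e' hxL m).symm

theorem resAlong_base (m : M.obj H) : M.resAlong (FixPts.base H) m = m := by
  rw [FixPts.base, resAlong_mk _ (by rw [map_one, one_smul]) le_rfl, M.res_self,
    M.conj_self 1 H.one_mem]

theorem Hom.app_resAlong {N : MackeyFunctor.{u, v} G} (f : Hom M N) (σ : FixPts H K)
    (m : M.obj K) : f.app H (M.resAlong σ m) = N.resAlong σ (f.app K m) :=
  (f.app_res σ.le_conj_out _).trans (congrArg _ (f.app_conj σ.1.out rfl m))

end ResAlong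

variable [Finite G]

section Free

variable {V : Rep.{v} ℚ (WeylGroup H)} {K L : Subgroup G}

variable (V) in
/-- The component at `σ` of an element of `F_H V (G/K)`. -/
noncomputable def freeEval (σ : FixPts H K) : (free V).obj K →ₗ[ℚ] V :=
  LinearMap.proj σ ∘ₗ (freeObj V K).subtype

theorem free_ext {y z : (free V).obj K} (h : ∀ σ, freeEval V σ y = freeEval V σ z) : y = z :=
  Subtype.ext (funext h)

theorem freeEval_res (h : K ≤ L) (σ : FixPts H K) (y : (free V).obj L) :
    freeEval V σ ((free V).res h y) = freeEval V (FixPts.proj h σ) y := rfl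

theorem freeEval_conj (g : G) (e : L = MulAut.conj g • K) (σ : FixPts H L)
    (y : (free V).obj K) :
    freeEval V σ ((free V).conj g e y) = freeEval V (FixPts.rmul g e σ) y := rfl

theorem freeEval_lmul (n : Subgroup.normalizer (H : Set G)) (σ : FixPts H K)
    (y : (free V).obj K) :
    freeEval V (FixPts.lmul n σ) y = V.ρ (n : WeylGroup H) (freeEval V σ y) :=
  y.2 n σ

theorem isIdemPart_free (V : Rep.{v} ℚ (WeylGroup H)) : IsIdemPart H (free V) := by
  refine isIdemPart_of_eq_zero_of_res_eq_zero fun K y hy => free_ext fun σ => ?_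
  obtain ⟨g, hg, rfl⟩ := FixPts.exists_mk σ
  have hle : MulAut.conj g⁻¹ • H ≤ K := by
    rw [map_inv, Subgroup.pointwise_smul_subset_iff, inv_inv]
    exact (FinGSet.fixed_mk_iff H K g).1 hg
  have hfix : ∀ h ∈ H, h • (g : G ⧸ (MulAut.conj g⁻¹ • H : Subgroup G)) = g := by
    rw [FinGSet.fixed_mk_iff, map_inv, smul_inv_smul]
  change freeEval V (FixPts.proj hle (FixPts.mk g hfix)) y = _
  rw [← freeEval_res, hy, map_zero, map_zero]

theorem bijective_freeEval_base (V : Rep.{v} ℚ (WeylGroup H)) :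
    Function.Bijective (freeEval V (FixPts.base H)) := by
  -- The point `H` generates `(G/H)^H` freely under `W_G H`.
  choose n hn using FixPts.exists_lmul_base (H := H)
  constructor
  · refine fun y z h => free_ext fun σ => ?_
    rw [← hn σ, freeEval_lmul, freeEval_lmul, h]
  · refine fun v => ⟨⟨fun σ => V.ρ (n σ : WeylGroup H) v, fun k σ => ?_⟩, ?_⟩
    · have hmul : (n (FixPts.lmul k σ) : WeylGroup H) = k * n σ :=
        (FixPts.lmul_base_eq_iff _ (k * n σ)).1 (by rw [FixPts.lmul_mul, hn, hn])
      change V.ρ (n (FixPts.lmul k σ) : WeylGroup H) v =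
        V.ρ (k : WeylGroup H) (V.ρ (n σ : WeylGroup H) v)
      rw [hmul, map_mul, Module.End.mul_apply]
    · have hone : (n (FixPts.base H) : WeylGroup H) = 1 :=
        (FixPts.lmul_base_eq_iff _ 1).1 ((hn _).trans (Subtype.ext (one_smul G _).symm))
      change V.ρ (n (FixPts.base H) : WeylGroup H) v = v
      rw [hone, map_one, Module.End.one_apply]

end Free

section Unit

variable {M : MackeyFunctor.{u, max u w} G}

variable (M H) in
/-- The map `M(G/K) → F_H (M(G/H)) (G/K)` whose component at `σ` is induced by the `G`-map
`G/H → G/K` that sends `H` to `σ`. -/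
noncomputable def toFreeApp (K : Subgroup G) :
    M.obj K →ₗ[ℚ] (free (Rep.of (M.weylRep H))).obj K :=
  LinearMap.codRestrict (freeObj (Rep.of (M.weylRep H)) K) (LinearMap.pi M.resAlong)
    fun m n σ => (conj_resAlong n (conj_eq_of_mem_normalizer n.2) σ m).symm

theorem freeEval_toFreeApp {K : Subgroup G} (σ : FixPts H K) (m : M.obj K) :
    freeEval (Rep.of (M.weylRep H)) σ (M.toFreeApp H K m) = M.resAlong σ m := rfl

/-- The morphism `M ⟶ F_H (M(G/H))`, for `M` in `e_H Mack(G)`. -/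
noncomputable def IsIdemPart.toFree (hM : IsIdemPart H M) :
    Hom M (free (Rep.of (M.weylRep H))) :=
  hM.homMk (isIdemPart_free _) (M.toFreeApp H)
    (fun h m => free_ext fun σ => by
      rw [freeEval_res, freeEval_toFreeApp, freeEval_toFreeApp, resAlong_res])
    (fun g _ _ e m => free_ext fun σ => by
      rw [freeEval_conj, freeEval_toFreeApp, freeEval_toFreeApp, resAlong_conj])

theorem bijective_toFreeApp_self : Function.Bijective (M.toFreeApp H H) := by
  have hcomp : freeEval (Rep.of (M.weylRep H)) (FixPts.base H) ∘ M.toFreeApp H H = id :=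
    funext resAlong_base
  rw [← (bijective_freeEval_base (Rep.of (M.weylRep H))).of_comp_iff', hcomp]
  exact Function.bijective_id

end Unit

section Equivalence

variable (H)

/-- The functor `F_H` on representations of `W_G H`, with values in `e_H Mack(G)`. -/
noncomputable def freeIdem : Rep.{max u w} ℚ (WeylGroup H) ⥤ IdemMackey.{u, max u w} H :=
  (IsIdemPart.{u, max u w} H).lift (freeRep H) isIdemPart_free

/-- The unit of `idemEquivalenceRep`. -/
noncomputable def toFreeNatTrans :
    𝟭 (IdemMackey.{u, max u w} H) ⟶ (ObjectProperty.ι _ ⋙ evalRep H) ⋙ freeIdem.{u, w} H where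
  app M := ObjectProperty.homMk M.property.toFree
  naturality _ _ f := ObjectProperty.hom_ext _ <| hom_ext fun _ m => free_ext fun σ =>
    (Hom.app_resAlong f.hom σ m).symm

/-- The counit of `idemEquivalenceRep`. -/
noncomputable def freeEvalNatTrans :
    freeIdem.{u, w} H ⋙ (ObjectProperty.ι _ ⋙ evalRep H) ⟶ 𝟭 (Rep.{max u w} ℚ (WeylGroup H)) where
  app V := Rep.ofHom (ρ := (free V).weylRep H) (σ := V.ρ)
    { freeEval V (FixPts.base H) with
      isIntertwining' := by
        intro x
        induction x using QuotientGroup.induction_on with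
        | H n =>
          refine LinearMap.ext fun y => ?_
          change freeEval V (FixPts.rmul (n : G) _ (FixPts.base H)) y = _
          rw [FixPts.rmul_base, freeEval_lmul]
          rfl }
  naturality _ _ _ := rfl

instance isIso_toFreeNatTrans : IsIso (toFreeNatTrans.{u, w} H) := by
  refine @NatIso.isIso_of_isIso_app _ _ _ _ _ _ _ fun M => ?_
  rw [← ObjectProperty.isIso_hom_iff]
  exact isIso_of_bijective M.property.toFree
    (M.property.bijective_app (isIdemPart_free _) bijective_toFreeApp_self)

instance isIso_freeEvalNatTrans : IsIso (freeEvalNatTrans.{u, w} H) := by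
  refine @NatIso.isIso_of_isIso_app _ _ _ _ _ _ _ fun V => ?_
  refine @isIso_of_reflects_iso _ _ _ _ _ _ _ (forget _) ?_ _
  rw [isIso_iff_bijective]
  exact bijective_freeEval_base V

/-- The equivalence between `e_H Mack(G)` and representations of `W_G H` given by evaluation at
`G/H` and `F_H`. -/
noncomputable def idemEquivalenceRep :
    IdemMackey.{u, max u w} H ≌ Rep.{max u w} ℚ (WeylGroup H) :=
  CategoryTheory.Equivalence.mk (ObjectProperty.ι _ ⋙ evalRep H) (freeIdem.{u, w} H)
    (asIso (toFreeNatTrans.{u, w} H)) (asIso (freeEvalNatTrans.{u, w} H))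

/-- The equivalence between `e_H Mack(G)` and `ℚ[W_G H]`-modules given by `U_H` and `F_H`. -/
noncomputable def idemEquivalence :
    IdemMackey.{u, max u w} H ≌ ModuleCat.{max u w} ℚ[WeylGroup H] :=
  (idemEquivalenceRep.{u, w} H).trans Rep.equivalenceModuleMonoidAlgebra

theorem isIdemPart_F (V : ModuleCat.{max u w} ℚ[WeylGroup H]) :
    IsIdemPart.{u, max u w} H ((F H).obj V) :=
  isIdemPart_free _

end Equivalence

end MackeyFunctor

/-! ### The splitting of the category of Mackey functors -/

namespace MackeyFunctor

variable {G : Type u} [Group G]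

section Sub

variable (M : MackeyFunctor.{u, v} G) (P : ∀ K : Subgroup G, Submodule ℚ (M.obj K))
  (hres : ∀ {K L : Subgroup G} (h : K ≤ L), ∀ m ∈ P L, M.res h m ∈ P K)
  (hind : ∀ {K L : Subgroup G} (h : K ≤ L), ∀ m ∈ P K, M.ind h m ∈ P L)
  (hconj : ∀ (g : G) {K L : Subgroup G} (e : L = MulAut.conj g • K), ∀ m ∈ P K,
    M.conj g e m ∈ P L)

/-- The Mackey functor formed by a family of submodules closed under the structure maps. -/
def sub : MackeyFunctor.{u, v} G where
  obj K := P K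
  res h := (M.res h).restrict (hres h)
  ind h := (M.ind h).restrict (hind h)
  conj g _ _ e := (M.conj g e).restrict (hconj g e)
  res_self K m := Subtype.ext (M.res_self K m.1)
  ind_self K m := Subtype.ext (M.ind_self K m.1)
  conj_self h hh e m := Subtype.ext (M.conj_self h hh e m.1)
  res_trans h h' m := Subtype.ext (M.res_trans h h' m.1)
  ind_trans h h' m := Subtype.ext (M.ind_trans h h' m.1)
  conj_mul g h _ _ _ e e' e'' m := Subtype.ext (M.conj_mul g h e e' e'' m.1)
  res_conj g _ _ _ _ h h' e e' m := Subtype.ext (M.res_conj g h h' e e' m.1)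
  ind_conj g _ _ _ _ h h' e e' m := Subtype.ext (M.ind_conj g h h' e e' m.1)
  mackey hK hL s hs m := Subtype.ext <| by
    rw [AddSubmonoidClass.coe_finsetSum]
    exact M.mackey hK hL s hs m.1

end Sub

section Pi

variable {ι : Type w} (M : ι → MackeyFunctor.{u, max w v} G)

/-- The product of a family of Mackey functors. -/
def pi : MackeyFunctor.{u, max w v} G where
  obj K := ∀ i, (M i).obj K
  res h := LinearMap.pi fun i => (M i).res h ∘ₗ LinearMap.proj i
  ind h := LinearMap.pi fun i => (M i).ind h ∘ₗ LinearMap.proj i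
  conj g _ _ e := LinearMap.pi fun i => (M i).conj g e ∘ₗ LinearMap.proj i
  res_self K m := funext fun i => (M i).res_self K (m i)
  ind_self K m := funext fun i => (M i).ind_self K (m i)
  conj_self h hh e m := funext fun i => (M i).conj_self h hh e (m i)
  res_trans h h' m := funext fun i => (M i).res_trans h h' (m i)
  ind_trans h h' m := funext fun i => (M i).ind_trans h h' (m i)
  conj_mul g h _ _ _ e e' e'' m := funext fun i => (M i).conj_mul g h e e' e'' (m i)
  res_conj g _ _ _ _ h h' e e' m := funext fun i => (M i).res_conj g h h' e e' (m i)
  ind_conj g _ _ _ _ h h' e e' m := funext fun i => (M i).ind_conj g h h' e e' (m i)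
  mackey hK hL s hs m := funext fun i => by
    rw [Finset.sum_apply]
    exact (M i).mackey hK hL s hs (m i)

/-- The projections of a product of Mackey functors. -/
def piProj (i : ι) : Hom (pi.{u, v, w} M) (M i) where
  app _ := LinearMap.proj i
  app_res _ _ := rfl
  app_ind _ _ := rfl
  app_conj _ _ _ _ _ := rfl

variable {M} in
/-- The morphism into a product of Mackey functors with given components. -/
def piLift {N : MackeyFunctor.{u, max w v} G} (f : ∀ i, Hom N (M i)) :
    Hom N (pi.{u, v, w} M) where
  app K := LinearMap.pi fun i => (f i).app K
  app_res h m := funext fun i => (f i).app_res h m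
  app_ind h m := funext fun i => (f i).app_ind h m
  app_conj g _ _ e m := funext fun i => (f i).app_conj g e m

open Classical in
/-- The inclusion of a factor into a product of Mackey functors. -/
noncomputable def piSingle (i : ι) : Hom (M i) (pi.{u, v, w} M) where
  app K := LinearMap.single ℚ (fun i => (M i).obj K) i
  app_res h m := funext fun j =>
    (Pi.apply_single (fun j => (M j).res h) (fun _ => map_zero _) i m j).symm
  app_ind h m := funext fun j =>
    (Pi.apply_single (fun j => (M j).ind h) (fun _ => map_zero _) i m j).symm
  app_conj g _ _ e m := funext fun j =>
    (Pi.apply_single (fun j => (M j).conj g e) (fun _ => map_zero _) i m j).symm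

theorem piSingle_same (i : ι) {K : Subgroup G} (m : (M i).obj K) :
    (piSingle.{u, v, w} M i).app K m i = m := by
  classical
  exact Pi.single_eq_same (M := fun i => (M i).obj K) i m

theorem piSingle_of_ne {i j : ι} (h : j ≠ i) {K : Subgroup G} (m : (M i).obj K) :
    (piSingle.{u, v, w} M i).app K m j = 0 := by
  classical
  exact Pi.single_eq_of_ne (M := fun i => (M i).obj K) h m

theorem pi_globalAct {K : Subgroup G} (a : BurnsideRing G)
    (m : (pi.{u, v, w} M).obj K) (i : ι) :
    (pi.{u, v, w} M).globalAct K a m i = (M i).globalAct K a (m i) :=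
  (piProj M i).app_globalAct K a m

end Pi

section Decomposition

variable [Finite G]

section IdemPart

variable (M : MackeyFunctor.{u, v} G) (H : Subgroup G)

/-- The part `e_H M` of a Mackey functor `M`. -/
noncomputable def idemPart : MackeyFunctor.{u, v} G :=
  M.sub (fun K => LinearMap.range (M.globalAct K (BurnsideRing.idem H)))
    (by rintro K L h _ ⟨m, rfl⟩; exact ⟨_, (M.res_globalAct h _ m).symm⟩)
    (by rintro K L h _ ⟨m, rfl⟩; exact ⟨_, (M.ind_globalAct h _ m).symm⟩)
    (by rintro g K L e _ ⟨m, rfl⟩; exact ⟨_, (M.conj_globalAct g e _ m).symm⟩)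

/-- The inclusion of `e_H M` into `M`. -/
noncomputable def idemPartι : Hom (M.idemPart H) M where
  app K := (LinearMap.range (M.globalAct K (BurnsideRing.idem H))).subtype
  app_res _ _ := rfl
  app_ind _ _ := rfl
  app_conj _ _ _ _ _ := rfl

/-- The projection of a Mackey functor `M` onto `e_H M`. -/
noncomputable def toIdemPart : Hom M (M.idemPart H) where
  app K := (M.globalAct K (BurnsideRing.idem H)).rangeRestrict
  app_res h m := Subtype.ext (M.res_globalAct h _ m).symm
  app_ind h m := Subtype.ext (M.ind_globalAct h _ m).symm
  app_conj g _ _ e m := Subtype.ext (M.conj_globalAct g e _ m).symm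

theorem isIdemPart_idemPart : IsIdemPart H (M.idemPart H) := by
  rw [isIdemPart_iff]
  rintro K ⟨_, m, rfl⟩
  refine Subtype.ext (((M.idemPartι H).app_globalAct K (BurnsideRing.idem H) ⟨_, m, rfl⟩).trans ?_)
  change M.globalAct K _ (M.globalAct K _ m) = M.globalAct K _ m
  rw [← globalAct_mul, (BurnsideRing.isIdempotentElem_idem H).eq]

end IdemPart

variable {rep : ConjSub G → Subgroup G}

theorem bijective_toIdemPart (hrep : ∀ c, ConjSub.mk (rep c) = c)
    (M : MackeyFunctor.{u, v} G) (K : Subgroup G) :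
    Function.Bijective fun (m : M.obj K) (c : ConjSub G) => (M.toIdemPart (rep c)).app K m := by
  have := Fintype.ofFinite (ConjSub G)
  have horth := BurnsideRing.completeOrthogonalIdempotents_idem hrep
  have hsum (m : M.obj K) : ∑ c, M.globalAct K (BurnsideRing.idem (rep c)) m = m := by
    rw [← LinearMap.sum_apply, ← map_sum, horth.complete, globalAct_one]
  constructor
  · intro m m' h
    rw [← hsum m, ← hsum m']
    exact Finset.sum_congr rfl fun c _ => congrArg Subtype.val (congrFun h c)
  · intro y
    choose z hz using fun c => (y c).2
    refine ⟨∑ d, M.globalAct K (BurnsideRing.idem (rep d)) (z d),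
      funext fun c => Subtype.ext ?_⟩
    change M.globalAct K _ _ = (y c).1
    rw [map_sum, Finset.sum_eq_single_of_mem c (Finset.mem_univ c), ← globalAct_mul,
      (horth.idem c).eq, hz]
    intro d _ hd
    rw [← globalAct_mul, horth.ortho hd.symm, map_zero, LinearMap.zero_apply]

theorem pi_globalAct_idem (hrep : ∀ c, ConjSub.mk (rep c) = c)
    (M : ∀ c, IdemMackey.{u, max u w} (rep c)) {K : Subgroup G} (c : ConjSub G)
    (m : (pi.{u, w, u} fun c => (M c).obj).obj K) :
    (pi.{u, w, u} fun c => (M c).obj).globalAct K (BurnsideRing.idem (rep c)) m =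
      (piSingle.{u, w, u} (fun c => (M c).obj) c).app K (m c) := by
  classical
  funext d
  rw [pi_globalAct, (M d).property.globalAct_eq_smul, BurnsideRing.marks_idem, hrep, hrep]
  obtain rfl | h := eq_or_ne d c
  · rw [Pi.single_eq_same, one_smul, piSingle_same]
  · rw [Pi.single_eq_of_ne h, zero_smul, piSingle_of_ne _ h]

variable (rep) in
/-- The product functor `∏ e_H Mack(G) ⥤ Mack(G)`. -/
noncomputable def piFunctor :
    (∀ c, IdemMackey.{u, max u w} (rep c)) ⥤ MackeyFunctor.{u, max u w} G where
  obj M := pi.{u, w, u} fun c => (M c).obj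
  map {M _} f := piLift.{u, w, u} fun c =>
    show Hom _ _ from piProj.{u, w, u} (fun c => (M c).obj) c ≫ (f c).hom

instance piFunctor_faithful : (piFunctor.{u, w} rep).Faithful where
  map_injective {M N f f'} h := by
    funext c
    refine ObjectProperty.hom_ext _ (hom_ext fun K m => ?_)
    have hc : (f c).hom.app K ((piSingle.{u, w, u} (fun c => (M c).obj) c).app K m c) =
        (f' c).hom.app K ((piSingle.{u, w, u} (fun c => (M c).obj) c).app K m c) :=
      congrFun (congrArg (Hom.app · K ((piSingle.{u, w, u} (fun c => (M c).obj) c).app K m)) h) c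
    rwa [piSingle_same] at hc

theorem piFunctor_full (hrep : ∀ c, ConjSub.mk (rep c) = c) : (piFunctor.{u, w} rep).Full where
  map_surjective {M N} f := by
    refine ⟨fun c => ObjectProperty.homMk (X := M c) (Y := N c)
      (show (M c).obj ⟶ (N c).obj from piSingle.{u, w, u} (fun c => (M c).obj) c ≫ f ≫
        piProj.{u, w, u} (fun c => (N c).obj) c), hom_ext fun K m => funext fun c => ?_⟩
    change Hom.app f K ((piSingle.{u, w, u} (fun c => (M c).obj) c).app K (m c)) c =
      Hom.app f K m c
    -- Since `f` commutes with the action of `e_c`, it preserves the factor of index `c`.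
    refine (congrFun (congrArg (Hom.app f K) (pi_globalAct_idem hrep M c m).symm) c).trans ?_
    refine (congrFun (Hom.app_globalAct f K _ m) c).trans ?_
    exact (congrFun (pi_globalAct_idem hrep N c _) c).trans (piSingle_same _ c _)

theorem piFunctor_essSurj (hrep : ∀ c, ConjSub.mk (rep c) = c) :
    (piFunctor.{u, w} rep).EssSurj where
  mem_essImage M := by
    let f : M ⟶ pi.{u, w, u} fun c => M.idemPart (rep c) :=
      piLift.{u, w, u} fun c => M.toIdemPart (rep c)
    have : IsIso f := isIso_of_bijective f fun K => bijective_toIdemPart hrep M K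
    exact ⟨fun c => ⟨M.idemPart (rep c), isIdemPart_idemPart M (rep c)⟩, ⟨(asIso f).symm⟩⟩

/-- The splitting of the category of rational Mackey functors by the idempotents of the Burnside
ring. -/
noncomputable def piEquivalence (hrep : ∀ c, ConjSub.mk (rep c) = c) :
    (∀ c, IdemMackey.{u, max u w} (rep c)) ≌ MackeyFunctor.{u, max u w} G :=
  have : (piFunctor.{u, w} rep).IsEquivalence :=
    { full := piFunctor_full hrep
      essSurj := piFunctor_essSurj hrep }
  (piFunctor.{u, w} rep).asEquivalence

end Decomposition

end MackeyFunctor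

end RatMackey

open RatMackey RatMackey.MackeyFunctor in
theorem mainTheorem1 (G : Type u) [Group G] [Finite G] :
    (∀ H : Subgroup G,
      ∃ hF : ∀ V : ModuleCat.{max u w} ℚ[WeylGroup H], IsIdemPart.{u, max u w} H ((F H).obj V),
      ∃ E : IdemMackey.{u, max u w} H ≌ ModuleCat.{max u w} ℚ[WeylGroup H],
        E.functor = U H ∧ E.inverse = (IsIdemPart.{u, max u w} H).lift (F H) hF) ∧
    ∀ rep : ConjSub G → Subgroup G, (∀ c, ConjSub.mk (rep c) = c) →
      Nonempty (MackeyFunctor.{u, max u w} G ≌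
        ∀ c : ConjSub G, ModuleCat.{max u w} ℚ[WeylGroup (rep c)]) :=
  ⟨fun H => ⟨isIdemPart_F H, idemEquivalence.{u, w} H, rfl, rfl⟩,
    fun rep hrep => ⟨(piEquivalence.{u, w} hrep).symm.trans
      (Equivalence.pi fun c => idemEquivalence.{u, w} (rep c))⟩⟩
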